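/- Let $p$ be a prime, $r_1,r_p\in\mathbb{Q}$, and let $D$ be a positive integer with $Dr_1,Dr_p\in\mathbb{Z}$. Put $k'=(r_1+r_p)/2$, $n_\infty=(r_1+pr_p)/24$, $n_1=(pr_1+r_p)/24$, and let $k\in k'+2\mathbb{Z}$ with $k>2$. All complex powers are principal, $e(x)=\exp(2\pi i x)$, and $s(h,c)=\sum_{r \bmod c}((r/c))((hr/c))$ is the Dedekind sum, where $((x))=x-\lfloor x\rfloor-1/2$ for $x\notin\mathbb{Z}$ and $((x))=0$ for $x\in\mathbb{Z}$. For a positive integer $N$, the $N$-cover of $\mathrm{SL}_2(\mathbb{R})$ is the group of pairs $\left(\gamma,\varepsilon(c\tau+d)^{1/N}\right)$ with $\gamma=\begin{pmatrix}a&b\\c&d\end{pmatrix}\in\mathrm{SL}_2(\mathbb{R})$ and $\varepsilon^N=1$, with product $(\gamma,\varphi)(\gamma',\varphi')=(\gamma\gamma',\varphi(\gamma'\tau)\varphi'(\tau))$; put $\widetilde\gamma=(\gamma,(c\tau+d)^{1/N})$. For a subgroup $G\subseteq\mathrm{SL}_2(\mathbb{Z})$ let $\widetilde{G^{N}}$ be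 its preimage. For $\kappa\in\frac1N\mathbb{Z}$ and $f\colon\mathbb{H}\to\mathbb{C}$ let $f|_\kappa(\gamma,\varepsilon(c\tau+d)^{1/N})(\tau)=\varepsilon^{-N\kappa}(c\tau+d)^{-\kappa}f(\gamma\tau)$. If $G$ has finite index in $\mathrm{SL}_2(\mathbb{Z})$ and $\chi\colon\widetilde{G^N}\to\mathbb{C}^\times$ is a character whose kernel has finite index, then $M_\kappa(\widetilde{G^{N}};\chi)$ is the space of holomorphic $f$ on $\mathbb{H}$ such that $f|_\kappa\gamma=\chi(\gamma)f$ for all $\gamma\in\widetilde{G^{N}}$ and $\lim_{\operatorname{Im}\tau\to+\infty}f|_\kappa\gamma$ exists for all $\gamma\in\widetilde{\mathrm{SL}_2(\mathbb{Z})^{N}}$. Let $\eta$ be the Dedekind eta function, $\log\eta(\tau)=\log\eta(i)+\int_i^\tau\frac{\eta'(z)}{\eta(z)}\,dz$ with $\log\eta(i)$ real, and $\eta^r(\tau)=\exp(r\log\eta(\tau))$. There is a unique character $\chi_{r_1,r_p}\colon\widetilde{\Gamma_0(p)^{2D}}\to\mathbb{C}^\times$ with $f|_{k'}\gamma=\chi_{r_1,r_p}(\gamma)f$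 for all $\gamma\in\widetilde{\Gamma_0(p)^{2D}}$, where $f(\tau)=\eta^{r_1}(\tau)\eta^{r_p}(p\tau)$; its kernel has finite index. Let $T=\begin{pmatrix}1&1\\0&1\end{pmatrix}$ and $\gamma_1=\begin{pmatrix}1&0\\1&1\end{pmatrix}$, with lifts taken in the $2D$-cover. 1. $\chi_{r_1,r_p}(\widetilde T)=1$ if and only if $n_\infty\in\mathbb{Z}$. In this case $$E^{i\infty}_{k,p}(\tau;r_1,r_p)=1+\sum_{\substack{p\mid c>0,\ d\in\mathbb{Z}\\ \gcd(c,d)=1}}(c\tau+d)^{-k}\,e\!\left(-r_1\Big(\tfrac{a+d}{24c}+\tfrac12 s(-d,c)-\tfrac18\Big)-r_p\Big(\tfrac{a+d}{24c/p}+\tfrac12 s(-d,c/p)-\tfrac18\Big)\right),$$ where for each pair $(c,d)$, $a$ is any integer with $ad\equiv1\pmod c$, is well defined (its terms do not depend on the choice of $a$, and it converges absolutely for every $\tau\in\mathbb{H}$) and belongs to $M_k(\widetilde{\Gamma_0(p)^{2D}};\chi_{r_1,r_p})$. 2. $\chi_{r_1,r_p}(\widetilde{\gamma_1}\widetilde T^p\widetilde{\gamma_1}^{-1})=1$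 if and only if $n_1\in\mathbb{Z}$. In this case $$E^{1}_{k,p}(\tau;r_1,r_p)=\sum_{\substack{c>0,\ d\in\mathbb{Z}\\ \gcd(c,d)=\gcd(p,c)=1}}(c\tau+d)^{-k}\,e\!\left(-r_1\Big(\tfrac{a+b+d}{24(a+c)}+\tfrac12 s(-b-d,a+c)-\tfrac18\Big)-r_p\Big(\tfrac{a+b+d}{24(a+c)/p}+\tfrac12 s(-b-d,\tfrac{a+c}{p})-\tfrac18\Big)\right),$$ where for each pair $(c,d)$, $a,b$ are any integers with $ad-bc=1$, $p\mid a+c$ and $a+c>0$, is well defined (its terms do not depend on the choice of $a,b$, and it converges absolutely for every $\tau\in\mathbb{H}$) and belongs to $M_k(\widetilde{\Gamma_0(p)^{2D}};\chi_{r_1,r_p})$. -/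

import Mathlib

open scoped MatrixGroups UpperHalfPlane

noncomputable section

namespace RationalWeight

/-! ### The `D`-cover of `SL(2, ℝ)` -/

/-- The factor `c τ + d` of `m = (a, b; c, d)`. -/
def autFactor (m : SL(2, ℝ)) (τ : ℍ) : ℂ := (m 1 0 : ℂ) * τ + (m 1 1 : ℂ)

/-- The principal branch of the `D`-th root of `c τ + d`. -/
def rootFactor (D : ℕ) (m : SL(2, ℝ)) (τ : ℍ) : ℂ := autFactor m τ ^ ((D : ℂ)⁻¹)

lemma autFactor_ne_zero (m : SL(2, ℝ)) (τ : ℍ) : autFactor m τ ≠ 0 := by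
  have h := UpperHalfPlane.denom_ne_zero (m : GL (Fin 2) ℝ) τ
  simpa [UpperHalfPlane.denom, autFactor] using h

lemma autFactor_mul (m n : SL(2, ℝ)) (τ : ℍ) :
    autFactor (m * n) τ = autFactor m (n • τ) * autFactor n τ := by
  have h := autFactor_ne_zero n τ
  have h2 : ((n • τ : ℍ) : ℂ) = ((n 0 0 : ℂ) * τ + (n 0 1 : ℂ)) / autFactor n τ := by
    rw [UpperHalfPlane.coe_specialLinearGroup_apply]
    simp [autFactor]
  have e0 : (m * n) 1 0 = m 1 0 * n 0 0 + m 1 1 * n 1 0 := by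
    simp [Matrix.mul_apply, Fin.sum_univ_two]
  have e1 : (m * n) 1 1 = m 1 0 * n 0 1 + m 1 1 * n 1 1 := by
    simp [Matrix.mul_apply, Fin.sum_univ_two]
  rw [autFactor, autFactor, h2, add_mul, mul_assoc, div_mul_cancel₀ _ h, autFactor, e0, e1]
  push_cast
  ring

lemma rootFactor_ne_zero (D : ℕ) (m : SL(2, ℝ)) (τ : ℍ) : rootFactor D m τ ≠ 0 := by
  simp [rootFactor, Complex.cpow_eq_zero_iff, autFactor_ne_zero]

lemma rootFactor_one (D : ℕ) (τ : ℍ) : rootFactor D 1 τ = 1 := by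
  simp [rootFactor, autFactor]

lemma continuous_rootFactor (D : ℕ) (m : SL(2, ℝ)) : Continuous (rootFactor D m) := by
  by_cases hc : m 1 0 = 0
  · have : rootFactor D m = fun _ => ((m 1 1 : ℝ) : ℂ) ^ ((D : ℂ)⁻¹) := by
      funext τ
      simp [rootFactor, autFactor, hc]
    rw [this]
    exact continuous_const
  · have hcont : Continuous (autFactor m) := by
      unfold autFactor
      fun_prop
    refine hcont.cpow continuous_const fun τ => ?_
    refine Complex.mem_slitPlane_iff.mpr (Or.inr ?_)
    have : (autFactor m τ).im = m 1 0 * τ.im := by simp [autFactor]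
    rw [this]
    exact mul_ne_zero hc τ.im_ne_zero

/-- The quotient that enters the composition law of the `D`-cover. -/
def cocycleAt (D : ℕ) (m n : SL(2, ℝ)) (τ : ℍ) : ℂ :=
  rootFactor D m (n • τ) * rootFactor D n τ / rootFactor D (m * n) τ

lemma cocycleAt_pow (D : ℕ) [NeZero D] (m n : SL(2, ℝ)) (τ : ℍ) :
    cocycleAt D m n τ ^ D = 1 := by
  have hD : D ≠ 0 := NeZero.ne D
  rw [cocycleAt, div_pow, mul_pow]
  simp only [rootFactor, Complex.cpow_nat_inv_pow _ hD]
  rw [← autFactor_mul]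
  exact div_self (autFactor_ne_zero _ _)

lemma continuous_cocycleAt (D : ℕ) (m n : SL(2, ℝ)) : Continuous (cocycleAt D m n) := by
  have hs : Continuous fun τ : ℍ => n • τ := continuous_const_smul n
  exact (((continuous_rootFactor D m).comp hs).mul (continuous_rootFactor D n)).div₀
    (continuous_rootFactor D (m * n)) fun τ => rootFactor_ne_zero D _ τ

/-- The quotient `cocycleAt` is constant in `τ`. -/
lemma cocycleAt_const (D : ℕ) [NeZero D] (m n : SL(2, ℝ)) (τ τ' : ℍ) :
    cocycleAt D m n τ = cocycleAt D m n τ' := by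
  have hfin : Set.Finite {z : ℂ | z ^ D = 1} := by
    have hD : 0 < D := NeZero.pos D
    refine Set.Finite.subset (Polynomial.nthRoots D (1 : ℂ)).toFinset.finite_toSet fun z hz => ?_
    simpa [Polynomial.mem_nthRoots hD] using hz
  exact isPreconnected_univ.constant_of_mapsTo hfin.isDiscrete
    (continuous_cocycleAt D m n).continuousOn (fun t _ => cocycleAt_pow D m n t)
    (Set.mem_univ τ) (Set.mem_univ τ')

/-- An element `(m, ε (c τ + d)^{1/D})` with `ε ^ D = 1` of the `D`-cover of `SL(2, ℝ)`. -/
@[ext]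
structure Cover (D : ℕ) where
  mat : SL(2, ℝ)
  eps : ℂ
  eps_pow : eps ^ D = 1

namespace Cover

variable {D : ℕ} [NeZero D]

/-- `(m₁, ε₁) (m₂, ε₂) = (m₁ m₂, ε₁ ε₂ δ)`; the quotient defining `δ` does not depend on the
point at which it is evaluated (`cocycleAt_const`). -/
instance : Mul (Cover D) where
  mul g h := ⟨g.mat * h.mat, g.eps * h.eps * cocycleAt D g.mat h.mat UpperHalfPlane.I, by
    rw [mul_pow, mul_pow, g.eps_pow, h.eps_pow, cocycleAt_pow, one_mul, one_mul]⟩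

instance : One (Cover D) where
  one := ⟨1, 1, one_pow D⟩

instance : Inv (Cover D) where
  inv g := ⟨g.mat⁻¹, (g.eps * cocycleAt D g.mat⁻¹ g.mat UpperHalfPlane.I)⁻¹, by
    rw [inv_pow, mul_pow, g.eps_pow, cocycleAt_pow, one_mul, inv_one]⟩

lemma eps_ne_zero (g : Cover D) : g.eps ≠ 0 := by
  intro h
  have := g.eps_pow
  rw [h, zero_pow (NeZero.ne D)] at this
  exact zero_ne_one this

lemma cocycleAt_ne_zero (m n : SL(2, ℝ)) (τ : ℍ) : cocycleAt D m n τ ≠ 0 := by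
  intro h
  have := cocycleAt_pow D m n τ
  rw [h, zero_pow (NeZero.ne D)] at this
  exact zero_ne_one this

lemma cocycle_assoc (l m n : SL(2, ℝ)) (τ : ℍ) :
    cocycleAt D l m τ * cocycleAt D (l * m) n τ =
      cocycleAt D m n τ * cocycleAt D l (m * n) τ := by
  rw [cocycleAt_const D l m τ (n • τ)]
  simp only [cocycleAt, mul_smul, mul_assoc]
  have h1 := rootFactor_ne_zero D (l * m) (n • τ)
  have h2 := rootFactor_ne_zero D (m * n) τ
  have h3 := rootFactor_ne_zero D (l * (m * n)) τ
  field_simp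

instance : Group (Cover D) :=
  Group.ofLeftAxioms
    (by
      intro f g h
      refine Cover.ext (mul_assoc f.mat g.mat h.mat) ?_
      have key := cocycle_assoc (D := D) f.mat g.mat h.mat UpperHalfPlane.I
      change f.eps * g.eps * cocycleAt D f.mat g.mat UpperHalfPlane.I * h.eps *
          cocycleAt D (f.mat * g.mat) h.mat UpperHalfPlane.I =
        f.eps * (g.eps * h.eps * cocycleAt D g.mat h.mat UpperHalfPlane.I) *
          cocycleAt D f.mat (g.mat * h.mat) UpperHalfPlane.I
      linear_combination f.eps * g.eps * h.eps * key)
    (by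
      intro g
      refine Cover.ext (one_mul g.mat) ?_
      change 1 * g.eps * cocycleAt D 1 g.mat UpperHalfPlane.I = g.eps
      have h := rootFactor_ne_zero D g.mat UpperHalfPlane.I
      rw [cocycleAt, rootFactor_one, one_mul, one_mul, one_mul, div_self h, mul_one])
    (by
      intro g
      refine Cover.ext (inv_mul_cancel g.mat) ?_
      change (g.eps * cocycleAt D g.mat⁻¹ g.mat UpperHalfPlane.I)⁻¹ * g.eps *
        cocycleAt D g.mat⁻¹ g.mat UpperHalfPlane.I = 1
      rw [mul_assoc]
      exact inv_mul_cancel₀ (mul_ne_zero g.eps_ne_zero (cocycleAt_ne_zero _ _ _)))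

variable (D) in
/-- The natural projection onto `SL(2, ℝ)`. -/
def proj : Cover D →* SL(2, ℝ) where
  toFun := Cover.mat
  map_one' := rfl
  map_mul' _ _ := rfl

variable (D) in
/-- The lift `m̃ = (m, (c τ + d)^{1/D})` of an integral matrix. -/
def lift (m : SL(2, ℤ)) : Cover D :=
  ⟨Matrix.SpecialLinearGroup.map (Int.castRingHom ℝ) m, 1, one_pow D⟩

variable (D) in
/-- The preimage in the `D`-cover of a subgroup of `SL(2, ℤ)`. -/
def preimage (G : Subgroup SL(2, ℤ)) : Subgroup (Cover D) :=
  (G.map (Matrix.SpecialLinearGroup.map (Int.castRingHom ℝ))).comap (proj D)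

end Cover

/-! ### Modular forms of rational weight -/

/-- The slash operator `(f|_k γ)(τ) = ε^{-Dk} (c τ + d)^{-k} f(γ τ)` on the `D`-cover, used for
`k ∈ (1/D) ℤ`, so that `-Dk` is an integer. All powers are principal. -/
def slash {D : ℕ} (k : ℚ) (f : ℍ → ℂ) (γ : Cover D) (τ : ℍ) : ℂ :=
  γ.eps ^ (-((D : ℂ) * (k : ℂ))) * autFactor γ.mat τ ^ (-(k : ℂ)) * f (γ.mat • τ)

lemma slash_zero {D : ℕ} (k : ℚ) (γ : Cover D) : slash k (0 : ℍ → ℂ) γ = 0 := by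
  funext τ
  simp [slash]

lemma slash_add {D : ℕ} (k : ℚ) (f g : ℍ → ℂ) (γ : Cover D) :
    slash k (f + g) γ = slash k f γ + slash k g γ := by
  funext τ
  simp [slash, mul_add]

lemma slash_smul {D : ℕ} (k : ℚ) (c : ℂ) (f : ℍ → ℂ) (γ : Cover D) :
    slash k (c • f) γ = c • slash k f γ := by
  funext τ
  simp only [slash, Pi.smul_apply, smul_eq_mul]
  ring

/-- `f|_k γ = χ(γ) f` for all `γ` in the `D`-cover of `G`. -/
def HasMultiplier {D : ℕ} [NeZero D] {G : Subgroup SL(2, ℤ)} (k : ℚ) (f : ℍ → ℂ)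
    (χ : Cover.preimage D G →* ℂˣ) : Prop :=
  ∀ γ : Cover.preimage D G, slash k f (γ : Cover D) = (χ γ : ℂ) • f

/-- The space `M_k` of modular forms of weight `k` on the `D`-cover of `G` with character `χ`. -/
def modularForms {D : ℕ} [NeZero D] {G : Subgroup SL(2, ℤ)} (k : ℚ)
    (χ : Cover.preimage D G →* ℂˣ) : Submodule ℂ (ℍ → ℂ) where
  carrier := {f | MDifferentiable (modelWithCornersSelf ℂ ℂ) (modelWithCornersSelf ℂ ℂ) f ∧
    HasMultiplier k f χ ∧
    ∀ γ ∈ Cover.preimage D (⊤ : Subgroup SL(2, ℤ)),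
      ∃ L : ℂ, Filter.Tendsto (slash k f γ) UpperHalfPlane.atImInfty (nhds L)}
  zero_mem' := by
    refine ⟨mdifferentiable_const, fun γ => ?_, fun γ _ => ⟨0, ?_⟩⟩
    · rw [slash_zero, smul_zero]
    · rw [slash_zero]
      exact tendsto_const_nhds
  add_mem' := by
    rintro f g ⟨hf1, hf2, hf3⟩ ⟨hg1, hg2, hg3⟩
    refine ⟨hf1.add hg1, fun γ => ?_, fun γ hγ => ?_⟩
    · rw [slash_add, hf2 γ, hg2 γ, smul_add]
    · obtain ⟨L, hL⟩ := hf3 γ hγ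
      obtain ⟨M, hM⟩ := hg3 γ hγ
      exact ⟨L + M, by rw [slash_add]; exact hL.add hM⟩
  smul_mem' := by
    rintro c f ⟨hf1, hf2, hf3⟩
    refine ⟨hf1.const_smul c, fun γ => ?_, fun γ hγ => ?_⟩
    · rw [slash_smul, hf2 γ, smul_comm]
    · obtain ⟨L, hL⟩ := hf3 γ hγ
      exact ⟨c • L, by rw [slash_smul]; exact hL.const_smul c⟩

/-! ### Rational powers of the Dedekind eta function -/

/-- `log η(τ) = log η(i) + ∫_i^τ η'(z)/η(z) dz`, the integral being taken along the segment from
`i` to `τ`. Here `η(i) > 0` and `log η(i)` is the real logarithm. -/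
def logEta (τ : ℂ) : ℂ :=
  (Real.log (ModularForm.eta Complex.I).re : ℂ) +
    ∫ t in (0 : ℝ)..1,
      logDeriv ModularForm.eta (Complex.I + t * (τ - Complex.I)) * (τ - Complex.I)

/-- `η^r(τ) = exp(r log η(τ))`. -/
def etaPow (r : ℚ) (τ : ℂ) : ℂ := Complex.exp (r * logEta τ)

/-- The eta-quotient `η^{r₁}(τ) η^{r_p}(p τ)`. -/
def etaQuotient (p : ℕ) (r₁ rp : ℚ) (τ : ℍ) : ℂ := etaPow r₁ τ * etaPow rp (p * τ)

/-! ### The matrices `T` and `γ₁` -/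

/-- `γ₁ = (1, 0; 1, 1)`. -/
def gammaOne : SL(2, ℤ) := ⟨!![1, 0; 1, 1], by simp [Matrix.det_fin_two]⟩

/-- The element `T̃` of the `D`-cover of `Γ₀(p)`. -/
def tildeT (D : ℕ) [NeZero D] (p : ℕ) : Cover.preimage D (CongruenceSubgroup.Gamma0 p) :=
  ⟨Cover.lift D ModularGroup.T, ModularGroup.T, by
    show ModularGroup.T ∈ CongruenceSubgroup.Gamma0 p
    rw [CongruenceSubgroup.Gamma0_mem]
    simp [ModularGroup.T], rfl⟩

/-- The element `γ̃₁ T̃^p γ̃₁⁻¹` of the `D`-cover of `Γ₀(p)`. -/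
def tildeConj (D : ℕ) [NeZero D] (p : ℕ) : Cover.preimage D (CongruenceSubgroup.Gamma0 p) :=
  ⟨Cover.lift D gammaOne * Cover.lift D ModularGroup.T ^ p * (Cover.lift D gammaOne)⁻¹,
    gammaOne * ModularGroup.T ^ p * gammaOne⁻¹, by
      have hT : ((ModularGroup.T ^ p : SL(2, ℤ)) : Matrix (Fin 2) (Fin 2) ℤ) =
          !![1, (p : ℤ); 0, 1] := by
        simpa using ModularGroup.coe_T_zpow (p : ℤ)
      have hG : (gammaOne : Matrix (Fin 2) (Fin 2) ℤ) = !![1, 0; 1, 1] := rfl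
      have h : (gammaOne * ModularGroup.T ^ p * gammaOne⁻¹) 1 0 = -(p : ℤ) := by
        rw [Matrix.SpecialLinearGroup.coe_mul, Matrix.SpecialLinearGroup.coe_mul,
          Matrix.SpecialLinearGroup.coe_inv, hT, hG, Matrix.adjugate_fin_two]
        simp [Matrix.mul_apply, Fin.sum_univ_two]
      show _ ∈ CongruenceSubgroup.Gamma0 p
      rw [CongruenceSubgroup.Gamma0_mem, h]
      simp, by
      simp only [map_mul, map_pow, map_inv]
      rfl⟩

/-! ### The Eisenstein series -/

/-- `((x)) = x - ⌊x⌋ - 1/2` if `x` is not an integer, and `0` otherwise. -/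
def sawtooth (x : ℚ) : ℚ := if Int.fract x = 0 then 0 else x - ⌊x⌋ - 1 / 2

/-- The Dedekind sum `s(h, k)` for `k ≥ 1`. -/
def dedekindSum (h k : ℤ) : ℚ :=
  ∑ r ∈ Finset.Ico 0 k, sawtooth ((r : ℚ) / k) * sawtooth ((h * r : ℚ) / k)

/-- `e(x) = exp(2 π i x)`. -/
def expTwoPiI (x : ℚ) : ℂ := Complex.exp (2 * Real.pi * Complex.I * x)

/-- The coefficient
`e(-r₁ ((a+d)/(24c) + s(-d,c)/2 - 1/8) - r_p ((a+d)/(24c/p) + s(-d,c/p)/2 - 1/8))`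
for `c > 0` divisible by `p`. -/
def eisCoeff (p : ℕ) (r₁ rp : ℚ) (a c d : ℤ) : ℂ :=
  expTwoPiI
    (-r₁ * (((a + d : ℤ) : ℚ) / (24 * c) + 1 / 2 * dedekindSum (-d) c - 1 / 8)
      - rp * (((a + d : ℤ) : ℚ) / (24 * c / p) + 1 / 2 * dedekindSum (-d) (c / p) - 1 / 8))

/-- The pairs `(c, d)` of coprime integers with `c > 0` and `p ∣ c`. -/
abbrev IndexInfty (p : ℕ) : Type :=
  {x : ℤ × ℤ // 0 < x.1 ∧ (p : ℤ) ∣ x.1 ∧ IsCoprime x.1 x.2}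

/-- The admissible `a` for a pair `(c, d)` in the series at `i∞`. -/
def AdmissibleInfty (c d a : ℤ) : Prop := a * d ≡ 1 [ZMOD c]

lemma exists_admissibleInfty {p : ℕ} (x : IndexInfty p) :
    ∃ a : ℤ, AdmissibleInfty x.1.1 x.1.2 a := by
  obtain ⟨u, v, h⟩ := x.2.2.2
  refine ⟨v, (Int.modEq_iff_dvd.mpr ⟨u, ?_⟩)⟩
  linear_combination -h

/-- The term of index `(c, d)` of the series at `i∞`, formed with the integer `a`. -/
def termInfty (p : ℕ) (k r₁ rp : ℚ) (c d a : ℤ) (τ : ℍ) : ℂ :=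
  ((c : ℂ) * τ + d) ^ (-(k : ℂ)) * eisCoeff p r₁ rp a c d

/-- The Eisenstein series `E_{k,p}^{i∞}(τ; r₁, r_p)`. -/
def eisInfty (p : ℕ) (k r₁ rp : ℚ) (τ : ℍ) : ℂ :=
  1 + ∑' x : IndexInfty p,
    termInfty p k r₁ rp x.1.1 x.1.2 (exists_admissibleInfty x).choose τ

/-- The pairs `(c, d)` of coprime integers with `c > 0` and `gcd(p, c) = 1`. -/
abbrev IndexOne (p : ℕ) : Type :=
  {x : ℤ × ℤ // 0 < x.1 ∧ IsCoprime (p : ℤ) x.1 ∧ IsCoprime x.1 x.2}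

/-- The admissible `(a, b)` for a pair `(c, d)` in the series at the cusp `1`. -/
def AdmissibleOne (p : ℕ) (c d : ℤ) (ab : ℤ × ℤ) : Prop :=
  ab.1 * d - ab.2 * c = 1 ∧ (p : ℤ) ∣ ab.1 + c ∧ 0 < ab.1 + c

lemma exists_admissibleOne {p : ℕ} [NeZero p] (x : IndexOne p) :
    ∃ ab : ℤ × ℤ, AdmissibleOne p x.1.1 x.1.2 ab := by
  obtain ⟨⟨c, d⟩, hc, ⟨s, t, hst⟩, ⟨u, v, huv⟩⟩ := x
  simp only at hc hst huv ⊢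
  have hp : (1 : ℤ) ≤ p := by exact_mod_cast NeZero.one_le
  -- shift `a = v` by `n c`, where `n ≡ -t (v + c)` modulo `p` is large
  set M : ℤ := |v| + |t * (v + c)| with hM
  have h1 : |v| ≤ M := by rw [hM]; linarith [abs_nonneg (t * (v + c))]
  have h2 : |t * (v + c)| ≤ M := by rw [hM]; linarith [abs_nonneg v]
  set n : ℤ := -(t * (v + c)) + p * (2 * M) with hn
  have hM0 : 0 ≤ M := le_trans (abs_nonneg v) h1
  have hnM : M ≤ n := by
    have := le_abs_self (t * (v + c))
    nlinarith
  refine ⟨(v + n * c, -u + n * d), ?_, ?_, ?_⟩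
  · simp only
    linear_combination huv
  · refine ⟨s * (v + c) + 2 * M * c, ?_⟩
    simp only [hn]
    linear_combination (-(v + c)) * hst
  · have := neg_abs_le v
    simp only
    nlinarith

/-- The term of index `(c, d)` of the series at the cusp `1`, formed with the integers `(a, b)`. -/
def termOne (p : ℕ) (k r₁ rp : ℚ) (c d : ℤ) (ab : ℤ × ℤ) (τ : ℍ) : ℂ :=
  ((c : ℂ) * τ + d) ^ (-(k : ℂ)) * eisCoeff p r₁ rp ab.1 (ab.1 + c) (ab.2 + d)

/-- The Eisenstein series `E_{k,p}^{1}(τ; r₁, r_p)`. -/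
def eisOne (p : ℕ) [NeZero p] (k r₁ rp : ℚ) (τ : ℍ) : ℂ :=
  ∑' x : IndexOne p, termOne p k r₁ rp x.1.1 x.1.2 (exists_admissibleOne x).choose τ

end RationalWeight

end

open scoped MatrixGroups UpperHalfPlane

noncomputable section

namespace RationalWeight

/-! ### Dedekind sums -/

/-! Each series is half of a Poincaré series. For `s` the lift of the identity or of `gammaOne`, sum
`χ(s g)⁻¹ (1|_k g)` over the bottom rows of those `g` with `s g` in the cover of Γ₀(p). A row
determines `g` up to a left factor `n` fixing i∞, so the summand depends only on the row precisely
when `χ(s n s⁻¹)` equals the weight `k` factor of `n`; this is `CuspCharacter`. Granting it, `χ` has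
absolute value 1 and the sum is dominated by `∑ |cτ + d|^{-k}` with `k > 2`. Absolute convergence
and holomorphy follow, right translation of rows gives the transformation law, and dominated
convergence gives the limits at the cusps (`CuspCharacter.poincare_mem`).

The cusp condition is read off from the eta-quotient `f`. Under the translations occurring in the
stabilizer, `f|s` is multiplied by integral powers of `e(n_∞)`, respectively `e(n_1)`. If that
number is an integer, `χ` agrees on the stabilizer with the factor of weight `k'`, and hence with
that of weight `k`, because `k - k'` is an even integer and the stabilizer consists of lifts of
signed translations. The same computation on `tildeT` and `tildeConj` gives the two equivalences.

The explicit coefficients come from `log η(γτ) = log η(τ) + (1/2) log(cτ + d) + C(γ)`. This holds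
because E₂ is quasimodular, so both sides have the same derivative. The values of `C` at S and T
come from fixed points. For `c > 0`, the Euclidean algorithm on the bottom row together with
Dedekind reciprocity identifies `C(γ)` with a Dedekind sum (`etaConst_eq_dedekindSum`). Consequently
the exponentials in the series are the inverses of the multiplier of `f` (`eisCoeff_eq`). Pairing
the rows `v` and `-v` produces the factor 2; at i∞ the rows `(0, ±1)` supply the constant term 1,
while at the cusp 1 no row has `c = 0`. -/

lemma sawtooth_neg (x : ℚ) : sawtooth (-x) = -sawtooth x := by
  unfold sawtooth
  by_cases h : Int.fract x = 0
  · rw [if_pos h, if_pos (Int.fract_neg_eq_zero.mpr h), neg_zero]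
  · rw [if_neg h, if_neg (mt Int.fract_neg_eq_zero.mp h)]
    have h1 := Int.fract_neg h
    have h2 := Int.self_sub_floor x
    have h3 := Int.self_sub_floor (-x)
    rw [h3, h2, h1]
    ring

lemma sawtooth_add_int (x : ℚ) (n : ℤ) : sawtooth (x + n) = sawtooth x := by
  unfold sawtooth
  simp only [Int.self_sub_floor, Int.fract_add_intCast]

lemma dedekindSum_neg (h k : ℤ) : dedekindSum (-h) k = -dedekindSum h k := by
  unfold dedekindSum
  rw [← Finset.sum_neg_distrib]
  refine Finset.sum_congr rfl fun r _ => ?_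
  rw [← mul_neg, ← sawtooth_neg]
  congr 2
  push_cast
  ring

lemma dedekindSum_add_mul (h k n : ℤ) : dedekindSum (h + n * k) k = dedekindSum h k := by
  unfold dedekindSum
  refine Finset.sum_congr rfl fun r hr => ?_
  have hk : (k : ℚ) ≠ 0 := by
    rw [Finset.mem_Ico] at hr
    exact_mod_cast (by omega : k ≠ 0)
  rw [← sawtooth_add_int ((h * r : ℚ) / k) (n * r)]
  congr 2
  push_cast
  field_simp

lemma sawtooth_div_of_coprime {h k r : ℕ} (hk : h.Coprime k) (hr : r < k) :
    sawtooth ((h * r : ℚ) / k) = if r = 0 then 0 else ((h * r % k : ℕ) : ℚ) / k - 1 / 2 := by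
  have hk0 : (k : ℚ) ≠ 0 := by exact_mod_cast (by omega : k ≠ 0)
  have hf : Int.fract ((h * r : ℚ) / k) = ((h * r % k : ℕ) : ℚ) / k := by
    have := Nat.cast_mul (α := ℚ) h r
    rw [← this, Int.fract_div_natCast_eq_div_natCast_mod]
  unfold sawtooth
  rw [Int.self_sub_floor, hf]
  by_cases hr0 : r = 0
  · simp [hr0]
  · have : h * r % k ≠ 0 := by
      intro h0
      exact absurd (Nat.le_of_dvd (by omega) (hk.symm.dvd_of_dvd_mul_left (Nat.dvd_of_mod_eq_zero h0)))
        (by omega)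
    rw [if_neg hr0, if_neg]
    exact div_ne_zero (by exact_mod_cast this) hk0

/-- Multiplication by a unit permutes the residues. -/
lemma sum_range_mul_mod {h k : ℕ} (hk : h.Coprime k) (φ : ℕ → ℚ) :
    ∑ r ∈ Finset.range k, φ (h * r % k) = ∑ r ∈ Finset.range k, φ r := by
  have hinj : Set.InjOn (fun r => h * r % k) (Finset.range k : Set ℕ) := by
    intro a ha b hb hab
    simp only [Finset.coe_range, Set.mem_Iio] at ha hb
    have : h * a ≡ h * b [MOD k] := hab
    exact Nat.ModEq.eq_of_lt_of_lt (Nat.ModEq.cancel_left_of_coprime hk.symm this) ha hb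
  have himg : (Finset.range k).image (fun r => h * r % k) = Finset.range k := by
    refine Finset.eq_of_subset_of_card_le ?_ (Finset.card_image_of_injOn hinj).ge
    intro x hx
    obtain ⟨r, hr, rfl⟩ := Finset.mem_image.mp hx
    exact Finset.mem_range.mpr (Nat.mod_lt _ (by have := Finset.mem_range.mp hr; omega))
  conv_rhs => rw [← himg, Finset.sum_image hinj]

lemma sum_range_cast (k : ℕ) : ∑ r ∈ Finset.range k, (r : ℚ) = k * (k - 1) / 2 := by
  induction k with
  | zero => simp
  | succ n ih => rw [Finset.sum_range_succ, ih]; push_cast; ring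

lemma sum_range_cast_sq (k : ℕ) :
    ∑ r ∈ Finset.range k, (r : ℚ) ^ 2 = k * (k - 1) * (2 * k - 1) / 6 := by
  induction k with
  | zero => simp
  | succ n ih => rw [Finset.sum_range_succ, ih]; push_cast; ring

lemma cast_mul_mod (h k r : ℕ) :
    ((h * r % k : ℕ) : ℚ) = h * r - k * ((h * r / k : ℕ) : ℚ) := by
  have := Nat.mod_add_div (h * r) k
  have h2 : ((h * r % k : ℕ) : ℚ) + k * ((h * r / k : ℕ) : ℚ) = h * r := by exact_mod_cast this
  linarith

/-- A Dedekind sum in terms of `∑ r ⌊h r / k⌋`. -/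
lemma dedekindSum_eq {h k : ℕ} (hk : h.Coprime k) (hk0 : 0 < k) :
    dedekindSum h k = h * ((k - 1) * (2 * k - 1)) / (6 * k)
      - (∑ r ∈ Finset.range k, (r : ℚ) * ((h * r / k : ℕ) : ℚ)) / k - (k - 1) / 4 := by
  have hkq : (k : ℚ) ≠ 0 := by exact_mod_cast hk0.ne'
  have h1 : dedekindSum h k = ∑ r ∈ Finset.range k,
      sawtooth ((r : ℚ) / k) * sawtooth ((h * r : ℚ) / k) := by
    unfold dedekindSum
    rw [Finset.range_eq_Ico]
    symm
    refine Finset.sum_bij (fun r _ => (r : ℤ)) ?_ ?_ ?_ ?_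
    · intro r hr
      simp only [Finset.mem_Ico] at hr ⊢
      omega
    · intro a _ b _ hab
      exact_mod_cast hab
    · intro b hb
      simp only [Finset.mem_Ico] at hb
      exact ⟨b.toNat, by simp only [Finset.mem_Ico]; omega, by omega⟩
    · intro r _
      push_cast
      rfl
  -- The last summand corrects `r = 0`, where the sawtooth is 0 by convention while the formula `x -
  -- 1/2` would contribute `1/4`.
  have h2 : ∀ r ∈ Finset.range k, sawtooth ((r : ℚ) / k) * sawtooth ((h * r : ℚ) / k) =
      (r : ℚ) * ((h * r % k : ℕ) : ℚ) / k ^ 2 - (r : ℚ) / (2 * k) -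
        ((h * r % k : ℕ) : ℚ) / (2 * k) + 1 / 4 - if r = 0 then 1 / 4 else 0 := by
    intro r hr
    have hr := Finset.mem_range.mp hr
    have e1 := sawtooth_div_of_coprime (Nat.coprime_one_left k) hr
    simp only [Nat.cast_one, one_mul, Nat.mod_eq_of_lt hr] at e1
    rw [e1, sawtooth_div_of_coprime hk hr]
    by_cases h0 : r = 0
    · simp [h0]
    · simp only [h0, if_false]
      field_simp
      ring
  rw [h1, Finset.sum_congr rfl h2]
  simp only [Finset.sum_sub_distrib, Finset.sum_add_distrib, ← Finset.sum_div,
    Finset.sum_const, Finset.card_range]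
  rw [sum_range_mul_mod hk (fun x => (x : ℚ)), sum_range_cast, Finset.sum_ite_eq' (Finset.range k)]
  simp only [cast_mul_mod, mul_sub, Finset.sum_sub_distrib]
  have h3 : ∑ r ∈ Finset.range k, (r : ℚ) * (h * r) = h * (k * (k - 1) * (2 * k - 1) / 6) := by
    rw [← sum_range_cast_sq, Finset.mul_sum]
    exact Finset.sum_congr rfl fun r _ => by ring
  have h4 : ∑ r ∈ Finset.range k, (r : ℚ) * (k * ((h * r / k : ℕ) : ℚ)) =
      k * ∑ r ∈ Finset.range k, (r : ℚ) * ((h * r / k : ℕ) : ℚ) := by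
    rw [Finset.mul_sum]
    exact Finset.sum_congr rfl fun r _ => by ring
  rw [h3, h4, if_pos (Finset.mem_range.mpr hk0)]
  simp only [nsmul_eq_mul]
  field_simp
  ring

lemma sum_range_div {h k : ℕ} (hk : h.Coprime k) (hk0 : 0 < k) :
    ∑ r ∈ Finset.range k, ((h * r / k : ℕ) : ℚ) = (h - 1) * (k - 1) / 2 := by
  have hkq : (k : ℚ) ≠ 0 := by exact_mod_cast hk0.ne'
  have h1 := sum_range_mul_mod hk (fun x => (x : ℚ))
  simp only [cast_mul_mod, Finset.sum_sub_distrib, ← Finset.mul_sum, sum_range_cast] at h1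
  have : (k : ℚ) * ∑ r ∈ Finset.range k, ((h * r / k : ℕ) : ℚ) = k * ((h - 1) * (k - 1) / 2) := by
    linarith
  exact mul_left_cancel₀ hkq this

/-- The remainders of `h r` modulo `k` permute the residues, so their squares sum to `∑ r²`;
expanding `(h r - k ⌊h r / k⌋)²` gives the relation. -/
lemma sum_range_div_sq {h k : ℕ} (hk : h.Coprime k) :
    (k : ℚ) ^ 2 * ∑ r ∈ Finset.range k, ((h * r / k : ℕ) : ℚ) ^ 2 =
      2 * h * k * (∑ r ∈ Finset.range k, (r : ℚ) * ((h * r / k : ℕ) : ℚ)) +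
        (1 - h ^ 2) * (k * (k - 1) * (2 * k - 1) / 6) := by
  have h1 := sum_range_mul_mod hk (fun x => (x : ℚ) ^ 2)
  have h2 : ∀ r : ℕ, ((h * r % k : ℕ) : ℚ) ^ 2 = (h : ℚ) ^ 2 * (r : ℚ) ^ 2 -
      2 * h * k * ((r : ℚ) * ((h * r / k : ℕ) : ℚ)) + (k : ℚ) ^ 2 * ((h * r / k : ℕ) : ℚ) ^ 2 := by
    intro r
    rw [cast_mul_mod]
    ring
  simp only [h2, Finset.sum_sub_distrib, Finset.sum_add_distrib, ← Finset.mul_sum,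
    sum_range_cast_sq] at h1
  linarith

/-- Summation over the lattice points on both sides of the diagonal of a rectangle. -/
lemma sum_mul_div_swap {h k : ℕ} (hk : h.Coprime k) (hh0 : 0 < h) (hk0 : 0 < k) :
    2 * ∑ j ∈ Finset.range h, (j : ℚ) * ((k * j / h : ℕ) : ℚ) =
      (k - 1) * (h * (h - 1)) - ∑ r ∈ Finset.range k, ((h * r / k : ℕ) : ℚ) ^ 2 -
        ∑ r ∈ Finset.range k, ((h * r / k : ℕ) : ℚ) := by
  -- `⌊k j / h⌋` counts the `r ≥ 1` with `h r ≤ k j`, and `j < h` forces `r < k`.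
  have h1 : ∀ j ∈ Finset.range h, (j : ℚ) * ((k * j / h : ℕ) : ℚ) =
      ∑ r ∈ Finset.Ico 1 k, if h * r ≤ k * j then (j : ℚ) else 0 := by
    intro j hj
    have hj := Finset.mem_range.mp hj
    rw [← Finset.sum_filter, Finset.sum_const]
    have : (Finset.Ico 1 k).filter (fun r => h * r ≤ k * j) = Finset.Ico 1 (k * j / h + 1) := by
      ext r
      simp only [Finset.mem_filter, Finset.mem_Ico]
      rw [Nat.lt_succ_iff, Nat.le_div_iff_mul_le hh0, mul_comm r h]
      constructor
      · rintro ⟨⟨a, b⟩, c⟩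
        exact ⟨a, c⟩
      · rintro ⟨a, c⟩
        refine ⟨⟨a, ?_⟩, c⟩
        by_contra hc
        push Not at hc
        have := Nat.mul_le_mul_left h hc
        have h5 : k * j < k * h := Nat.mul_lt_mul_of_pos_left hj hk0
        rw [mul_comm k h] at h5
        omega
    rw [this]
    simp [mul_comm]
  -- The complementary `j` are exactly those up to `⌊h r / k⌋`: coprimality excludes `k j = h r` for
  -- `1 ≤ r < k`.
  have h2 : ∀ r ∈ Finset.Ico 1 k, (∑ j ∈ Finset.range h, if h * r ≤ k * j then (j : ℚ) else 0) =
      (h : ℚ) * (h - 1) / 2 - (((h * r / k : ℕ) : ℚ) ^ 2 + ((h * r / k : ℕ) : ℚ)) / 2 := by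
    intro r hr
    have hr := Finset.mem_Ico.mp hr
    have e1 : (∑ j ∈ Finset.range h, if h * r ≤ k * j then (j : ℚ) else 0) =
        ∑ j ∈ Finset.range h, ((j : ℚ) - if ¬ h * r ≤ k * j then (j : ℚ) else 0) := by
      refine Finset.sum_congr rfl fun j _ => ?_
      split_ifs <;> simp_all
    have e2 : (Finset.range h).filter (fun j => ¬ h * r ≤ k * j) =
        Finset.range (h * r / k + 1) := by
      ext j
      simp only [Finset.mem_filter, Finset.mem_range]
      rw [Nat.lt_succ_iff, Nat.le_div_iff_mul_le hk0, mul_comm j k, not_le]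
      constructor
      · rintro ⟨_, b⟩
        exact b.le
      · intro b
        have hne : k * j ≠ h * r := by
          intro heq
          have : k ∣ r := hk.symm.dvd_of_dvd_mul_left ⟨j, heq.symm⟩
          exact absurd (Nat.le_of_dvd (by omega) this) (by omega)
        refine ⟨?_, lt_of_le_of_ne b hne⟩
        by_contra hc
        push Not at hc
        have := Nat.mul_le_mul_left k hc
        have h5 : h * r < h * k := Nat.mul_lt_mul_of_pos_left hr.2 hh0
        rw [mul_comm h k] at h5
        omega
    rw [e1, Finset.sum_sub_distrib, sum_range_cast, ← Finset.sum_filter, e2, sum_range_cast]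
    push_cast
    ring
  rw [Finset.sum_congr rfl h1, Finset.sum_comm, Finset.sum_congr rfl h2]
  have h3 : ∀ φ : ℕ → ℚ, φ 0 = 0 → ∑ r ∈ Finset.range k, φ r = ∑ r ∈ Finset.Ico 1 k, φ r := by
    intro φ hφ
    rw [Finset.range_eq_Ico, Finset.sum_eq_sum_Ico_succ_bot hk0, hφ, zero_add]
  rw [h3 _ (by simp), h3 _ (by simp)]
  simp only [Finset.sum_sub_distrib, ← Finset.sum_div, Finset.sum_add_distrib, Finset.sum_const,
    Nat.card_Ico, nsmul_eq_mul, Nat.cast_sub hk0]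
  push_cast
  ring

/-- The reciprocity law for Dedekind sums. -/
lemma dedekindSum_reciprocity {h k : ℕ} (hk : h.Coprime k) (hh0 : 0 < h) (hk0 : 0 < k) :
    dedekindSum h k + dedekindSum k h =
      -1 / 4 + ((h : ℚ) / k + k / h + 1 / (h * k)) / 12 := by
  have hkq : (k : ℚ) ≠ 0 := by exact_mod_cast hk0.ne'
  have hhq : (h : ℚ) ≠ 0 := by exact_mod_cast hh0.ne'
  rw [dedekindSum_eq hk hk0, dedekindSum_eq hk.symm hh0]
  have h1 := sum_range_div_sq hk
  have h2 := sum_mul_div_swap hk hh0 hk0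
  rw [sum_range_div hk hk0] at h2
  -- `A'` is expressed through `B` and `B` through `A`; in the reciprocity formula `A` then cancels
  -- and a rational identity in `h`, `k` is left.
  generalize ∑ r ∈ Finset.range k, (r : ℚ) * ((h * r / k : ℕ) : ℚ) = A at *
  generalize ∑ r ∈ Finset.range h, (r : ℚ) * ((k * r / h : ℕ) : ℚ) = A' at *
  generalize ∑ r ∈ Finset.range k, ((h * r / k : ℕ) : ℚ) ^ 2 = B at *
  have hA' : A' = ((k - 1) * (h * (h - 1)) - B - (h - 1) * (k - 1) / 2) / 2 := by linarith
  have hB : B = (2 * h * k * A + (1 - h ^ 2) * (k * (k - 1) * (2 * k - 1) / 6)) / k ^ 2 := by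
    rw [eq_div_iff (pow_ne_zero 2 hkq)]
    linarith
  rw [hA', hB]
  field_simp
  ring

/-! ### The logarithm of the eta function -/

/-- Eta has no zeros on the half-plane, so its logarithmic derivative has a primitive `F` on this
convex set, and the segment integral equals `F(z) - F(i)`. -/
lemma hasDerivAt_logEta {z : ℂ} (hz : 0 < z.im) :
    HasDerivAt logEta (logDeriv ModularForm.eta z) z := by
  set U : Set ℂ := {z | 0 < z.im} with hU
  have hUo : IsOpen U := isOpen_lt continuous_const Complex.continuous_im
  have hUc : Convex ℝ U := convex_halfSpace_im_gt 0
  have hd : DifferentiableOn ℂ (logDeriv ModularForm.eta) U := by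
    have h1 : DifferentiableOn ℂ ModularForm.eta U := fun x hx =>
      (ModularForm.differentiableAt_eta_of_mem_upperHalfPlaneSet hx).differentiableWithinAt
    exact (h1.deriv hUo).div h1 fun x hx => ModularForm.eta_ne_zero hx
  obtain ⟨F, hF⟩ := hUc.exists_forall_hasDerivWithinAt hd
  have hF' : ∀ w ∈ U, HasDerivAt F (logDeriv ModularForm.eta w) w := fun w hw =>
    (hF w hw).hasDerivAt (hUo.mem_nhds hw)
  have hI : Complex.I ∈ U := by simp [hU]
  have key : ∀ w ∈ U, logEta w =
      (Real.log (ModularForm.eta Complex.I).re : ℂ) + (F w - F Complex.I) := by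
    intro w hw
    unfold logEta
    congr 1
    have hmem : ∀ t ∈ Set.uIcc (0 : ℝ) 1, Complex.I + t * (w - Complex.I) ∈ U := by
      intro t ht
      rw [Set.uIcc_of_le zero_le_one] at ht
      have := hUc.add_smul_sub_mem hI hw ht
      simpa using this
    have hline : ∀ t : ℝ, HasDerivAt (fun t : ℝ => Complex.I + t * (w - Complex.I))
        (w - Complex.I) t := by
      intro t
      have := ((Complex.ofRealCLM.hasDerivAt (x := t)).mul_const (w - Complex.I)).const_add Complex.I
      simpa using this
    have hcont : ContinuousOn (fun t : ℝ =>
        logDeriv ModularForm.eta (Complex.I + t * (w - Complex.I)) * (w - Complex.I))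
        (Set.uIcc 0 1) := by
      refine ContinuousOn.mul ?_ continuousOn_const
      exact hd.continuousOn.comp (by fun_prop) hmem
    rw [intervalIntegral.integral_eq_sub_of_hasDerivAt
      (f := fun t : ℝ => F (Complex.I + t * (w - Complex.I))) (fun t ht => ?_)
      hcont.intervalIntegrable]
    · simp
    · exact (hF' _ (hmem t ht)).comp_of_eq t (hline t) rfl
  have h2 : HasDerivAt (fun w => (Real.log (ModularForm.eta Complex.I).re : ℂ) +
      (F w - F Complex.I)) (logDeriv ModularForm.eta z) z :=
    ((hF' z hz).sub_const _).const_add _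
  refine h2.congr_of_eventuallyEq ?_
  filter_upwards [hUo.mem_nhds hz] with w hw using key w hw

lemma denom_int_ne_zero (γ : SL(2, ℤ)) (τ : ℍ) : (γ 1 0 : ℂ) * τ + γ 1 1 ≠ 0 := by
  have h := UpperHalfPlane.denom_ne_zero (γ : GL (Fin 2) ℝ) τ
  simpa [UpperHalfPlane.denom] using h

/-- This is the quasimodularity of E₂, since `η'/η` is a constant multiple of E₂; the correction
term is the derivative of `(1/2) log(cτ + d)`. -/
lemma logDeriv_eta_smul (γ : SL(2, ℤ)) (τ : ℍ) :
    logDeriv ModularForm.eta ((γ • τ : ℍ) : ℂ) * (1 / ((γ 1 0 : ℂ) * τ + γ 1 1) ^ 2) =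
      logDeriv ModularForm.eta τ + 1 / 2 * ((γ 1 0 : ℂ) / ((γ 1 0 : ℂ) * τ + γ 1 1)) := by
  have h := congrFun (EisensteinSeries.E2_slash_action γ) τ
  have h0 := denom_int_ne_zero γ τ
  rw [ModularForm.SL_slash_apply] at h
  simp only [Pi.sub_apply, Pi.smul_apply, EisensteinSeries.D2, riemannZeta_two, smul_eq_mul,
    UpperHalfPlane.denom] at h
  simp at h
  rw [ModularForm.logDeriv_eta_eq_E2, ModularForm.logDeriv_eta_eq_E2]
  have hpi : (Real.pi : ℂ) ≠ 0 := by exact_mod_cast Real.pi_ne_zero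
  rw [show ∀ A B C : ℂ, A * B * (1 / C ^ 2) = A * (B * (C ^ 2)⁻¹) by intros; ring]
  have h' : EisensteinSeries.E2 (γ • τ) * (((γ 1 0 : ℂ) * τ + γ 1 1) ^ 2)⁻¹ =
      EisensteinSeries.E2 τ - 6 / (Real.pi : ℂ) ^ 2 * 2⁻¹ *
        (2 * Real.pi * Complex.I * γ 1 0 / ((γ 1 0 : ℂ) * τ + γ 1 1)) := h
  rw [h']
  field_simp
  linear_combination (-12 * (γ 1 0 : ℂ)) * Complex.I_sq

lemma coe_smul_int (γ : SL(2, ℤ)) (τ : ℍ) :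
    ((γ • τ : ℍ) : ℂ) = ((γ 0 0 : ℂ) * τ + γ 0 1) / ((γ 1 0 : ℂ) * τ + γ 1 1) := by
  rw [UpperHalfPlane.coe_specialLinearGroup_apply]
  simp

/-- The case `c = 0` is separate because `d` may then be a negative real, on the branch cut, where
the function is nevertheless constant. -/
lemma hasDerivAt_log_linear {c d z : ℂ} (h : c = 0 ∨ c * z + d ∈ Complex.slitPlane) :
    HasDerivAt (fun z => Complex.log (c * z + d)) (c / (c * z + d)) z := by
  rcases h with rfl | h
  · simpa using hasDerivAt_const z (Complex.log d)
  · have h1 : HasDerivAt (fun z => c * z + d) c z := by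
      simpa using ((hasDerivAt_id z).const_mul c).add_const d
    exact h1.clog h

lemma denom_int_slitPlane (γ : SL(2, ℤ)) (τ : ℍ) :
    (γ 1 0 : ℂ) = 0 ∨ (γ 1 0 : ℂ) * τ + γ 1 1 ∈ Complex.slitPlane := by
  by_cases hc : γ 1 0 = 0
  · exact Or.inl (by exact_mod_cast hc)
  · right
    refine Complex.mem_slitPlane_iff.mpr (Or.inr ?_)
    have : ((γ 1 0 : ℂ) * τ + γ 1 1).im = γ 1 0 * τ.im := by simp
    rw [this]
    exact mul_ne_zero (by exact_mod_cast hc) τ.im_ne_zero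

/-- The constant `C(γ)` in `log η(γ τ) = log η(τ) + (1/2) log (c τ + d) + C(γ)`. -/
def etaConst (γ : SL(2, ℤ)) : ℂ :=
  logEta ((γ • UpperHalfPlane.I : ℍ) : ℂ) - logEta (UpperHalfPlane.I : ℂ)
    - 1 / 2 * Complex.log ((γ 1 0 : ℂ) * (UpperHalfPlane.I : ℂ) + γ 1 1)

theorem logEta_smul (γ : SL(2, ℤ)) (τ : ℍ) :
    logEta ((γ • τ : ℍ) : ℂ) =
      logEta τ + 1 / 2 * Complex.log ((γ 1 0 : ℂ) * τ + γ 1 1) + etaConst γ := by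
  set U : Set ℂ := {z | 0 < z.im} with hU
  have hUo : IsOpen U := isOpen_lt continuous_const Complex.continuous_im
  have hUc : Convex ℝ U := convex_halfSpace_im_gt 0
  set G : ℂ → ℂ := fun z =>
    logEta (((γ 0 0 : ℂ) * z + γ 0 1) / ((γ 1 0 : ℂ) * z + γ 1 1)) - logEta z
      - 1 / 2 * Complex.log ((γ 1 0 : ℂ) * z + γ 1 1) with hG
  have hdet : (γ 0 0 : ℂ) * γ 1 1 - γ 0 1 * γ 1 0 = 1 := by
    have := γ.det_coe
    rw [Matrix.det_fin_two] at this
    exact_mod_cast this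
  -- The derivative of the Möbius map is `(cz + d)⁻²`, which turns `logDeriv_eta_smul` into the
  -- vanishing of `G'`.
  have hder : ∀ z ∈ U, HasDerivAt G 0 z := by
    intro z hz
    lift z to ℍ using hz
    have h0 := denom_int_ne_zero γ z
    have hm : HasDerivAt (fun z : ℂ => ((γ 0 0 : ℂ) * z + γ 0 1) / ((γ 1 0 : ℂ) * z + γ 1 1))
        (1 / ((γ 1 0 : ℂ) * z + γ 1 1) ^ 2) z := by
      have h1 : HasDerivAt (fun z : ℂ => (γ 0 0 : ℂ) * z + γ 0 1) (γ 0 0) (z : ℂ) := by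
        simpa using ((hasDerivAt_id (z : ℂ)).const_mul (γ 0 0 : ℂ)).add_const (γ 0 1 : ℂ)
      have h2 : HasDerivAt (fun z : ℂ => (γ 1 0 : ℂ) * z + γ 1 1) (γ 1 0) (z : ℂ) := by
        simpa using ((hasDerivAt_id (z : ℂ)).const_mul (γ 1 0 : ℂ)).add_const (γ 1 1 : ℂ)
      refine (h1.div h2 h0).congr_deriv ?_
      congr 1
      linear_combination hdet
    have hl := hasDerivAt_logEta (γ • z).im_pos
    have hl2 := HasDerivAt.comp_of_eq (z : ℂ) hl hm (coe_smul_int γ z)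
    rw [logDeriv_eta_smul] at hl2
    refine ((hl2.sub (hasDerivAt_logEta z.im_pos)).sub
      ((hasDerivAt_log_linear (denom_int_slitPlane γ z)).const_mul (1 / 2))).congr_deriv ?_
    ring
  have hconst : G τ = G (UpperHalfPlane.I : ℂ) := by
    refine hUc.is_const_of_fderivWithin_eq_zero (𝕜 := ℂ) (f := G) (fun z hz =>
      (hder z hz).differentiableAt.differentiableWithinAt) (fun z hz => ?_) τ.im_pos
      UpperHalfPlane.I.im_pos
    rw [fderivWithin_of_isOpen hUo hz]
    simpa using (hder z hz).hasFDerivAt.fderiv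
  have e1 : G τ = logEta ((γ • τ : ℍ) : ℂ) - logEta τ -
      1 / 2 * Complex.log ((γ 1 0 : ℂ) * τ + γ 1 1) := by
    rw [hG, coe_smul_int]
  have e2 : G (UpperHalfPlane.I : ℂ) = etaConst γ := by
    rw [hG, etaConst, coe_smul_int]
  rw [e1, e2] at hconst
  linear_combination hconst

lemma denom_int_mul (γ δ : SL(2, ℤ)) (τ : ℍ) :
    (((γ * δ) 1 0 : ℤ) : ℂ) * τ + (((γ * δ) 1 1 : ℤ) : ℂ) =
      ((γ 1 0 : ℂ) * (δ • τ : ℍ) + γ 1 1) * ((δ 1 0 : ℂ) * τ + δ 1 1) := by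
  have h := denom_int_ne_zero δ τ
  have e0 : (γ * δ) 1 0 = γ 1 0 * δ 0 0 + γ 1 1 * δ 1 0 := by
    simp [Matrix.mul_apply, Fin.sum_univ_two]
  have e1 : (γ * δ) 1 1 = γ 1 0 * δ 0 1 + γ 1 1 * δ 1 1 := by
    simp [Matrix.mul_apply, Fin.sum_univ_two]
  rw [coe_smul_int, e0, e1]
  push_cast
  field_simp
  ring

/-- The cocycle relation of `etaConst`. -/
lemma etaConst_mul (γ δ : SL(2, ℤ)) (τ : ℍ) :
    etaConst (γ * δ) = etaConst γ + etaConst δ + 1 / 2 *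
      (Complex.log ((γ 1 0 : ℂ) * (δ • τ : ℍ) + γ 1 1) + Complex.log ((δ 1 0 : ℂ) * τ + δ 1 1) -
        Complex.log ((((γ * δ) 1 0 : ℤ) : ℂ) * τ + (((γ * δ) 1 1 : ℤ) : ℂ))) := by
  have h1 := logEta_smul (γ * δ) τ
  have h2 := logEta_smul γ (δ • τ)
  have h3 := logEta_smul δ τ
  rw [mul_smul] at h1
  linear_combination h2 + h3 - h1

/-- The failure of `etaConst` to be additive is only the failure of principal logarithms to add, and
one point `τ` suffices to test it. -/
lemma etaConst_mul_of_log_eq (γ δ : SL(2, ℤ)) (τ : ℍ)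
    (h : Complex.log (((γ 1 0 : ℂ) * (δ • τ : ℍ) + γ 1 1) * ((δ 1 0 : ℂ) * τ + δ 1 1)) =
      Complex.log ((γ 1 0 : ℂ) * (δ • τ : ℍ) + γ 1 1) + Complex.log ((δ 1 0 : ℂ) * τ + δ 1 1)) :
    etaConst (γ * δ) = etaConst γ + etaConst δ := by
  rw [etaConst_mul γ δ τ, denom_int_mul, h]
  ring

lemma etaConst_one : etaConst 1 = 0 := by
  simp [etaConst]

/-- S fixes `i`, so the two values of `logEta` cancel and only `-(1/2) log i` is left. -/
lemma etaConst_S : etaConst ModularGroup.S = -(Real.pi * Complex.I / 4) := by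
  have h : ModularGroup.S • UpperHalfPlane.I = UpperHalfPlane.I := by
    ext
    rw [coe_smul_int]
    simp [ModularGroup.S]
  rw [etaConst, h]
  simp [ModularGroup.S, Complex.log_I]
  ring

lemma etaConst_mul_T (γ : SL(2, ℤ)) :
    etaConst (γ * ModularGroup.T) = etaConst γ + etaConst ModularGroup.T := by
  refine etaConst_mul_of_log_eq _ _ UpperHalfPlane.I ?_
  simp [ModularGroup.T]

lemma etaConst_T_mul (γ : SL(2, ℤ)) :
    etaConst (ModularGroup.T * γ) = etaConst ModularGroup.T + etaConst γ := by
  refine etaConst_mul_of_log_eq _ _ UpperHalfPlane.I ?_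
  simp [ModularGroup.T]

/-- ST fixes `ρ = w - 1` with `w = exp(πi/3)`, and its denominator there is `w`. Hence `(1/2) log w
+ C(S) + C(T) = 0`. -/
lemma etaConst_T : etaConst ModularGroup.T = Real.pi * Complex.I / 12 := by
  set w : ℂ := Complex.exp ((Real.pi / 3 : ℝ) * Complex.I) with hw
  have hw1 : w = 1 / 2 + (Real.sqrt 3 / 2 : ℝ) * Complex.I := by
    rw [hw, Complex.exp_mul_I, ← Complex.ofReal_cos, ← Complex.ofReal_sin, Real.cos_pi_div_three,
      Real.sin_pi_div_three]
    norm_num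
  have h3 : ((Real.sqrt 3 : ℝ) : ℂ) ^ 2 = 3 := by
    rw [← Complex.ofReal_pow, Real.sq_sqrt (by norm_num)]
    norm_num
  have hw2 : w ^ 2 - w + 1 = 0 := by
    rw [hw1]
    push_cast
    linear_combination (-(1 / 4 : ℂ)) * h3 + ((Real.sqrt 3 : ℂ) ^ 2 / 4) * Complex.I_sq
  have hw0 : w ≠ 0 := Complex.exp_ne_zero _
  have him : 0 < (w - 1).im := by
    rw [hw1]
    simp
  set ρ : ℍ := ⟨w - 1, him⟩ with hρ
  have hρc : (ρ : ℂ) = w - 1 := rfl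
  have hST : (ModularGroup.S * ModularGroup.T) 1 0 = 1 ∧
      (ModularGroup.S * ModularGroup.T) 1 1 = 1 ∧ (ModularGroup.S * ModularGroup.T) 0 0 = 0 ∧
      (ModularGroup.S * ModularGroup.T) 0 1 = -1 := by
    rw [Matrix.SpecialLinearGroup.coe_mul, ModularGroup.coe_S, ModularGroup.coe_T]
    simp
  have hfix : (ModularGroup.S * ModularGroup.T) • ρ = ρ := by
    ext
    rw [coe_smul_int, hST.1, hST.2.1, hST.2.2.1, hST.2.2.2, hρc]
    push_cast
    rw [show (1 : ℂ) * (w - 1) + 1 = w by ring, div_eq_iff hw0]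
    linear_combination -hw2
  have h := logEta_smul (ModularGroup.S * ModularGroup.T) ρ
  rw [hfix, hST.1, hST.2.1, hρc, etaConst_mul_T, etaConst_S] at h
  have hlog : Complex.log w = (Real.pi / 3 : ℝ) * Complex.I := by
    rw [hw, Complex.log_exp] <;> simp <;> linarith [Real.pi_pos]
  rw [show ((1 : ℤ) : ℂ) * (w - 1) + ((1 : ℤ) : ℂ) = w by push_cast; ring, hlog] at h
  push_cast at h
  linear_combination -h

lemma etaConst_mul_T_zpow (γ : SL(2, ℤ)) (m : ℤ) :
    etaConst (γ * ModularGroup.T ^ m) = etaConst γ + m * (Real.pi * Complex.I / 12) := by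
  induction m using Int.induction_on with
  | zero => simp
  | succ n ih =>
    rw [zpow_add_one, ← mul_assoc, etaConst_mul_T, ih, etaConst_T]
    push_cast
    ring
  | pred n ih =>
    have := etaConst_mul_T (γ * ModularGroup.T ^ (-(n : ℤ) - 1))
    rw [mul_assoc, ← zpow_add_one, sub_add_cancel, ih, etaConst_T] at this
    push_cast at this ⊢
    linear_combination -this

lemma etaConst_T_zpow_mul (γ : SL(2, ℤ)) (m : ℤ) :
    etaConst (ModularGroup.T ^ m * γ) = m * (Real.pi * Complex.I / 12) + etaConst γ := by
  induction m using Int.induction_on with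
  | zero => simp
  | succ n ih =>
    rw [add_comm (n : ℤ) 1, zpow_one_add, mul_assoc, etaConst_T_mul, ih, etaConst_T]
    push_cast
    ring
  | pred n ih =>
    have := etaConst_T_mul (ModularGroup.T ^ (-(n : ℤ) - 1) * γ)
    rw [← mul_assoc, ← zpow_one_add, add_sub_cancel, ih, etaConst_T] at this
    push_cast at this ⊢
    linear_combination -this

/-- The two arguments lie in `(0, π]`; if their sum exceeded `π`, its sine, and with it the
imaginary part of the product, would be nonpositive. -/
lemma log_mul_of_im_pos {z w : ℂ} (hz : 0 < z.im) (hw : 0 < w.im) (hzw : 0 < (z * w).im) :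
    Complex.log (z * w) = Complex.log z + Complex.log w := by
  have hz0 : z ≠ 0 := by rintro rfl; simp at hz
  have hw0 : w ≠ 0 := by rintro rfl; simp at hw
  have h1 : 0 < z.arg := lt_of_le_of_ne (Complex.arg_nonneg_iff.mpr hz.le)
    (fun h => hz.ne' (Complex.arg_eq_zero_iff.mp h.symm).2)
  have h2 : 0 < w.arg := lt_of_le_of_ne (Complex.arg_nonneg_iff.mpr hw.le)
    (fun h => hw.ne' (Complex.arg_eq_zero_iff.mp h.symm).2)
  refine Complex.log_mul hz0 hw0 ⟨by linarith [Real.pi_pos], ?_⟩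
  by_contra hc
  push Not at hc
  have h3 := Complex.arg_le_pi z
  have h4 := Complex.arg_le_pi w
  have h6 : (z * w).im = ‖z‖ * ‖w‖ * Real.sin (z.arg + w.arg) := by
    rw [Real.sin_add, Complex.mul_im]
    have a1 := Complex.norm_mul_cos_arg z
    have a2 := Complex.norm_mul_sin_arg z
    have a3 := Complex.norm_mul_cos_arg w
    have a4 := Complex.norm_mul_sin_arg w
    rw [← a1, ← a2, ← a3, ← a4]
    ring
  have h7 : Real.sin (z.arg + w.arg) ≤ 0 := by
    have := Real.sin_nonneg_of_nonneg_of_le_pi (x := z.arg + w.arg - Real.pi) (by linarith)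
      (by linarith)
    rw [Real.sin_sub_pi] at this
    linarith
  have h8 : 0 ≤ ‖z‖ * ‖w‖ := by positivity
  nlinarith

lemma etaConst_mul_of_pos (γ δ : SL(2, ℤ)) (hγ : 0 < γ 1 0) (hδ : 0 < δ 1 0)
    (hγδ : 0 < (γ * δ) 1 0) : etaConst (γ * δ) = etaConst γ + etaConst δ := by
  have him : ∀ (γ : SL(2, ℤ)) (τ : ℍ), 0 < γ 1 0 → 0 < ((γ 1 0 : ℂ) * τ + γ 1 1).im := by
    intro γ τ h
    have : ((γ 1 0 : ℂ) * τ + γ 1 1).im = γ 1 0 * τ.im := by simp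
    rw [this]
    exact mul_pos (by exact_mod_cast h) τ.im_pos
  refine etaConst_mul_of_log_eq γ δ UpperHalfPlane.I ?_
  refine log_mul_of_im_pos (him _ _ hγ) (him _ _ hδ) ?_
  rw [← denom_int_mul]
  exact him _ _ hγδ

/-- The constant `C(γ)` for `c > 0`, in terms of a Dedekind sum. -/
theorem etaConst_eq_dedekindSum (γ : SL(2, ℤ)) (hc : 0 < γ 1 0) :
    etaConst γ = Real.pi * Complex.I * (((γ 0 0 + γ 1 1 : ℚ) / (12 * γ 1 0) +
      dedekindSum (-(γ 1 1)) (γ 1 0) - 1 / 4 : ℚ) : ℂ) := by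
  obtain ⟨n, hn⟩ : ∃ n : ℕ, γ 1 0 = n := ⟨(γ 1 0).toNat, by omega⟩
  induction n using Nat.strong_induction_on generalizing γ with
  | _ n ih =>
  -- Right multiplication by `T^m` reduces `d` to its residue modulo `c`; both sides of the formula
  -- change by `m πi/12`.
  set m : ℤ := -(γ 1 1 / γ 1 0) with hm
  set δ : SL(2, ℤ) := γ * ModularGroup.T ^ m with hδ
  have hT := ModularGroup.coe_T_zpow m
  have d00 : δ 0 0 = γ 0 0 := by
    rw [hδ, Matrix.SpecialLinearGroup.coe_mul, hT]; simp [Matrix.mul_apply, Fin.sum_univ_two]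
  have d10 : δ 1 0 = γ 1 0 := by
    rw [hδ, Matrix.SpecialLinearGroup.coe_mul, hT]; simp [Matrix.mul_apply, Fin.sum_univ_two]
  have d11 : δ 1 1 = γ 1 1 + m * γ 1 0 := by
    rw [hδ, Matrix.SpecialLinearGroup.coe_mul, hT]
    simp [Matrix.mul_apply, Fin.sum_univ_two]; ring
  have hcq : (γ 1 0 : ℚ) ≠ 0 := by exact_mod_cast hc.ne'
  suffices hs : etaConst δ = Real.pi * Complex.I * (((δ 0 0 + δ 1 1 : ℚ) / (12 * δ 1 0) +
      dedekindSum (-(δ 1 1)) (δ 1 0) - 1 / 4 : ℚ) : ℂ) by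
    have h1 := etaConst_mul_T_zpow γ m
    rw [← hδ, hs, d00, d10, d11,
      show -(γ 1 1 + m * γ 1 0) = -γ 1 1 + (-m) * γ 1 0 by ring, dedekindSum_add_mul] at h1
    have h2 : ((γ 0 0 : ℚ) + ((γ 1 1 + m * γ 1 0 : ℤ) : ℚ)) / (12 * γ 1 0) =
        (γ 0 0 + γ 1 1 : ℚ) / (12 * γ 1 0) + m / 12 := by
      push_cast
      field_simp
      ring
    rw [h2] at h1
    push_cast at h1 ⊢
    linear_combination -h1
  have hd0 : 0 ≤ δ 1 1 := by
    rw [d11, hm, neg_mul, ← sub_eq_add_neg, mul_comm, ← Int.emod_def]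
    exact Int.emod_nonneg _ hc.ne'
  have hd1 : δ 1 1 < δ 1 0 := by
    rw [d11, d10, hm, neg_mul, ← sub_eq_add_neg, mul_comm, ← Int.emod_def]
    exact Int.emod_lt_of_pos _ hc
  rw [← d10] at hc hn
  clear_value δ m
  clear d00 d10 d11 hm hcq hδ hT
  have hdet : δ 0 0 * δ 1 1 - δ 0 1 * δ 1 0 = 1 := by
    have := δ.det_coe
    rwa [Matrix.det_fin_two] at this
  -- If `d = 0`, the determinant forces `c = 1` and the matrix is `T^a S`, the base of the
  -- induction.
  rcases hd0.eq_or_lt with h0 | hpos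
  · have h1 : δ 1 0 = 1 := by
      rw [← h0] at hdet
      have : δ 1 0 ∣ 1 := ⟨-δ 0 1, by linarith⟩
      exact Int.eq_one_of_dvd_one hc.le this
    have h2 : δ 0 1 = -1 := by
      rw [← h0, h1] at hdet
      linarith
    have h3 : δ = ModularGroup.T ^ (δ 0 0) * ModularGroup.S := by
      ext i j
      rw [Matrix.SpecialLinearGroup.coe_mul, ModularGroup.coe_T_zpow, ModularGroup.S]
      fin_cases i <;> fin_cases j <;> simp [Matrix.mul_apply, Fin.sum_univ_two, h1, h2, ← h0]
    rw [h3, etaConst_T_zpow_mul, etaConst_S, ← h3, ← h0, h1]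
    have h4 : dedekindSum (-0) 1 = 0 := by
      simp [dedekindSum, sawtooth]
    rw [h4]
    push_cast
    ring
  -- Euclidean step: `δ S` has bottom row `(d, -c)` with `0 < d < c`, so induction applies.
  -- Reciprocity converts `s(c, d)` into `s(-d, c)`.
  · have s00 : (δ * ModularGroup.S) 0 0 = δ 0 1 := by
      simp [Matrix.SpecialLinearGroup.coe_mul, ModularGroup.coe_S, Matrix.mul_apply,
        Fin.sum_univ_two]
    have s10 : (δ * ModularGroup.S) 1 0 = δ 1 1 := by
      simp [Matrix.SpecialLinearGroup.coe_mul, ModularGroup.coe_S, Matrix.mul_apply,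
        Fin.sum_univ_two]
    have s11 : (δ * ModularGroup.S) 1 1 = -δ 1 0 := by
      simp [Matrix.SpecialLinearGroup.coe_mul, ModularGroup.coe_S, Matrix.mul_apply,
        Fin.sum_univ_two]
    have h1 := ih (δ 1 1).toNat (by omega) (δ * ModularGroup.S) (by rw [s10]; exact hpos)
      (by rw [s10]; omega)
    rw [etaConst_mul_of_pos δ ModularGroup.S hc (by simp [ModularGroup.S]) (by rw [s10]; exact hpos),
      s00, s10, s11, etaConst_S, neg_neg] at h1
    obtain ⟨d, hd⟩ : ∃ d : ℕ, δ 1 1 = d := ⟨(δ 1 1).toNat, by omega⟩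
    have hcop : n.Coprime d := by
      rw [← Nat.isCoprime_iff_coprime, ← hn, ← hd]
      exact ⟨-δ 0 1, δ 0 0, by linarith⟩
    have hrec := dedekindSum_reciprocity hcop (by omega) (by omega)
    have hnq : (n : ℚ) ≠ 0 := by exact_mod_cast (by omega : n ≠ 0)
    have hdq : (d : ℚ) ≠ 0 := by exact_mod_cast (by omega : d ≠ 0)
    rw [hd, hn] at h1 hdet ⊢
    have hb : (δ 0 1 : ℚ) = (δ 0 0 * d - 1) / n := by
      rw [eq_div_iff hnq]
      have : (δ 0 0 : ℚ) * d - δ 0 1 * n = 1 := by exact_mod_cast hdet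
      linarith
    have hq : ((δ 0 1 : ℚ) + ((-(n : ℤ) : ℤ) : ℚ)) / (12 * ((d : ℤ) : ℚ)) + dedekindSum n d - 1 / 4
        = ((δ 0 0 : ℚ) + ((d : ℤ) : ℚ)) / (12 * ((n : ℤ) : ℚ)) + dedekindSum (-(d : ℤ)) n
          - 1 / 4 - 1 / 4 := by
      rw [dedekindSum_neg, hb]
      have : dedekindSum n d = -dedekindSum d n +
        (-1 / 4 + ((n : ℚ) / d + d / n + 1 / (n * d)) / 12) := by linarith
      rw [this]
      push_cast
      field_simp
      ring
    rw [hq] at h1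
    rw [Rat.cast_sub _ (1 / 4 : ℚ)] at h1
    have h14 : ((1 / 4 : ℚ) : ℂ) = 1 / 4 := by norm_num
    rw [h14] at h1
    linear_combination h1

/-- The constant `C(γ)` is an integral multiple of `π i / 12`. -/
lemma exists_etaConst_eq (γ : SL(2, ℤ)) :
    ∃ n : ℤ, etaConst γ = n * (Real.pi * Complex.I / 12) := by
  have hmul : ∀ γ δ : SL(2, ℤ), ∃ n : ℤ,
      etaConst (γ * δ) = etaConst γ + etaConst δ + n * (Real.pi * Complex.I / 12) := by
    intro γ δ
    set τ := UpperHalfPlane.I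
    have h1 := etaConst_mul γ δ τ
    -- The logarithms differ by `2πi n`; half of this is `12 n` units of `πi/12`.
    have h2 : Complex.exp (Complex.log ((γ 1 0 : ℂ) * (δ • τ : ℍ) + γ 1 1) +
        Complex.log ((δ 1 0 : ℂ) * τ + δ 1 1) -
        Complex.log ((((γ * δ) 1 0 : ℤ) : ℂ) * τ + (((γ * δ) 1 1 : ℤ) : ℂ))) = 1 := by
      rw [Complex.exp_sub, Complex.exp_add, Complex.exp_log (denom_int_ne_zero _ _),
        Complex.exp_log (denom_int_ne_zero _ _), Complex.exp_log (denom_int_ne_zero _ _),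
        ← denom_int_mul]
      exact div_self (denom_int_ne_zero _ _)
    obtain ⟨n, hn⟩ := Complex.exp_eq_one_iff.mp h2
    rw [hn] at h1
    exact ⟨12 * n, by rw [h1]; push_cast; ring⟩
  have hmem : γ ∈ Subgroup.closure {ModularGroup.S, ModularGroup.T} := by
    rw [SpecialLinearGroup.SL2Z_generators]
    trivial
  induction hmem using Subgroup.closure_induction with
  | mem x hx =>
    rcases hx with rfl | rfl
    · exact ⟨-3, by rw [etaConst_S]; push_cast; ring⟩
    · exact ⟨1, by rw [etaConst_T]; push_cast; ring⟩
  | one => exact ⟨0, by simp [etaConst_one]⟩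
  | mul x y _ _ hx hy =>
    obtain ⟨a, ha⟩ := hx
    obtain ⟨b, hb⟩ := hy
    obtain ⟨n, hn⟩ := hmul x y
    exact ⟨a + b + n, by rw [hn, ha, hb]; push_cast; ring⟩
  | inv x _ hx =>
    obtain ⟨a, ha⟩ := hx
    obtain ⟨n, hn⟩ := hmul x x⁻¹
    rw [mul_inv_cancel, etaConst_one, ha] at hn
    exact ⟨-a - n, by push_cast; linear_combination -hn⟩

/-! ### The slash operator is an action -/

/-- The automorphy factor `ε^{-Nk} (c τ + d)^{-k}` of the slash operator. -/
def slashFactor {N : ℕ} (k : ℚ) (g : Cover N) (τ : ℍ) : ℂ :=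
  g.eps ^ (-((N : ℂ) * (k : ℂ))) * autFactor g.mat τ ^ (-(k : ℂ))

lemma slash_apply {N : ℕ} (k : ℚ) (f : ℍ → ℂ) (g : Cover N) (τ : ℍ) :
    slash k f g τ = slashFactor k g τ * f (g.mat • τ) := rfl

lemma slashFactor_one {N : ℕ} (k : ℚ) (τ : ℍ) : slashFactor k (1 : Cover N) τ = 1 := by
  have h1 : (1 : Cover N).eps = 1 := rfl
  have h2 : (1 : Cover N).mat = 1 := rfl
  simp [slashFactor, h1, h2, autFactor]

section

variable {N : ℕ} [NeZero N]

/-- Since `N k` is an integer, the factor is an integral power of `ε (cτ + d)^{1/N}`, and such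
powers respect products without any choice of branch. -/
lemma slashFactor_eq_zpow {k : ℚ} {m : ℤ} (hm : (N : ℚ) * k = m) (g : Cover N) (τ : ℍ) :
    slashFactor k g τ = (g.eps * rootFactor N g.mat τ) ^ (-m) := by
  have hN : (N : ℂ) ≠ 0 := by exact_mod_cast NeZero.ne N
  have hm' : (N : ℂ) * (k : ℂ) = m := by exact_mod_cast hm
  rw [slashFactor, mul_zpow, hm', ← Int.cast_neg, Complex.cpow_intCast, rootFactor,
    ← Complex.cpow_mul_int]
  congr 2
  push_cast
  rw [← hm']
  field_simp

lemma slashFactor_ne_zero (k : ℚ) (g : Cover N) (τ : ℍ) : slashFactor k g τ ≠ 0 := by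
  simp [slashFactor, Complex.cpow_eq_zero_iff, autFactor_ne_zero, g.eps_ne_zero]

/-- The product of the cover is defined to make this hold at `i`; constancy of `cocycleAt` carries
it to every `τ`. -/
lemma eps_mul_rootFactor_mul (g h : Cover N) (τ : ℍ) :
    (g * h).eps * rootFactor N (g * h).mat τ =
      (g.eps * rootFactor N g.mat (h.mat • τ)) * (h.eps * rootFactor N h.mat τ) := by
  change g.eps * h.eps * cocycleAt N g.mat h.mat UpperHalfPlane.I *
    rootFactor N (g.mat * h.mat) τ = _
  rw [cocycleAt_const N g.mat h.mat UpperHalfPlane.I τ, cocycleAt]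
  have := rootFactor_ne_zero N (g.mat * h.mat) τ
  field_simp

lemma slashFactor_mul {k : ℚ} (hk : ∃ m : ℤ, (N : ℚ) * k = m) (g h : Cover N) (τ : ℍ) :
    slashFactor k (g * h) τ = slashFactor k g (h.mat • τ) * slashFactor k h τ := by
  obtain ⟨m, hm⟩ := hk
  simp only [slashFactor_eq_zpow hm]
  rw [eps_mul_rootFactor_mul, mul_zpow]

lemma slash_mul {k : ℚ} (hk : ∃ m : ℤ, (N : ℚ) * k = m) (f : ℍ → ℂ) (g h : Cover N) :
    slash k f (g * h) = slash k (slash k f g) h := by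
  funext τ
  simp only [slash_apply]
  rw [slashFactor_mul hk, show (g * h).mat = g.mat * h.mat from rfl, mul_smul]
  ring

lemma norm_eps (g : Cover N) : ‖g.eps‖ = 1 :=
  Complex.norm_eq_one_of_pow_eq_one g.eps_pow (NeZero.ne N)

lemma norm_slashFactor {k : ℚ} (hk : ∃ m : ℤ, (N : ℚ) * k = m) (g : Cover N) (τ : ℍ) :
    ‖slashFactor k g τ‖ = ‖autFactor g.mat τ‖ ^ (-(k : ℝ)) := by
  obtain ⟨m, hm⟩ := hk
  have hm' : (N : ℂ) * (k : ℂ) = m := by exact_mod_cast hm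
  rw [slashFactor, norm_mul, hm', ← Int.cast_neg, Complex.cpow_intCast, norm_zpow, norm_eps,
    one_zpow, one_mul, show -(k : ℂ) = ((-(k : ℝ) : ℝ) : ℂ) by push_cast; rfl,
    Complex.norm_cpow_real]

/-- Weights that differ by an even integer have the same factor on lifts of `±T^n`. -/
lemma slashFactor_add_two_mul {k : ℚ} (hk : ∃ m : ℤ, (N : ℚ) * k = m) (m : ℤ) (g : Cover N)
    (τ : ℍ) (hg : autFactor g.mat τ ^ 2 = 1) :
    slashFactor (k + 2 * m) g τ = slashFactor k g τ := by
  obtain ⟨l, hl⟩ := hk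
  have h2 : (N : ℚ) * (k + 2 * m) = (l + N * (2 * m) : ℤ) := by
    push_cast
    rw [← hl]
    ring
  rw [slashFactor_eq_zpow h2, slashFactor_eq_zpow hl, neg_add, zpow_add₀
    (mul_ne_zero g.eps_ne_zero (rootFactor_ne_zero N _ _))]
  -- An even change of weight contributes an even power of `cτ + d`, which is trivial because `(cτ +
  -- d)² = 1`.
  have h3 : (g.eps * rootFactor N g.mat τ) ^ (N : ℤ) = autFactor g.mat τ := by
    rw [zpow_natCast, mul_pow, g.eps_pow, one_mul, rootFactor, Complex.cpow_nat_inv_pow _ (NeZero.ne N)]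
  rw [show -((N : ℤ) * (2 * m)) = (N : ℤ) * ((2 : ℕ) * (-m)) by push_cast; ring, zpow_mul, h3,
    zpow_mul, zpow_natCast, hg, one_zpow, mul_one]

/-- A nonvanishing function that every element of the cover multiplies by a constant has a unique
multiplier system. -/
lemma existsUnique_hasMultiplier {G : Subgroup SL(2, ℤ)} {k : ℚ}
    (hk : ∃ m : ℤ, (N : ℚ) * k = m) {f : ℍ → ℂ} (hf : ∀ τ, f τ ≠ 0)
    (h : ∀ g ∈ Cover.preimage N G, ∃ c : ℂ, slash k f g = c • f) :
    ∃! χ : Cover.preimage N G →* ℂˣ, HasMultiplier k f χ := by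
  choose c hc using fun g : Cover.preimage N G => h g g.2
  have hfac : ∀ g : Cover.preimage N G, ∀ τ, c g = slash k f (g : Cover N) τ / f τ := by
    intro g τ
    rw [hc g, Pi.smul_apply, smul_eq_mul, mul_div_cancel_right₀ _ (hf τ)]
  have hne : ∀ g, c g ≠ 0 := by
    intro g
    rw [hfac g UpperHalfPlane.I, slash_apply]
    exact div_ne_zero (mul_ne_zero (slashFactor_ne_zero _ _ _) (hf _)) (hf _)
  have hmul : ∀ g h, c (g * h) = c g * c h := by
    intro g h
    have e : slash k f ((g * h : Cover.preimage N G) : Cover N) = (c g * c h) • f := by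
      rw [Subgroup.coe_mul, slash_mul hk, hc g, slash_smul, hc h, smul_smul]
    rw [hfac _ UpperHalfPlane.I, e, Pi.smul_apply, smul_eq_mul, mul_div_cancel_right₀ _ (hf _)]
  refine ⟨MonoidHom.mk' (fun g => Units.mk0 (c g) (hne g)) fun g h => ?_, fun g => ?_,
    fun χ hχ => ?_⟩
  · ext
    simp [hmul]
  · exact hc g
  · ext g
    have e := hχ g
    rw [hc g] at e
    have e2 := congrFun e UpperHalfPlane.I
    simp only [Pi.smul_apply, smul_eq_mul] at e2
    exact (mul_right_cancel₀ (hf _) e2).symm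

end

/-! ### The multiplier of the eta-quotient -/

/-- The conjugate `(a, p b; c / p, d)` of `(a, b; c, d)`. -/
def levelConj (p : ℕ) (γ : SL(2, ℤ)) (h : (p : ℤ) ∣ γ 1 0) : SL(2, ℤ) :=
  ⟨!![γ 0 0, p * γ 0 1; γ 1 0 / p, γ 1 1], by
    have hdet := γ.det_coe
    rw [Matrix.det_fin_two] at hdet
    rw [Matrix.det_fin_two_of, mul_assoc, mul_left_comm, Int.mul_ediv_cancel' h]
    exact hdet⟩

lemma levelConj_apply (p : ℕ) (γ : SL(2, ℤ)) (h : (p : ℤ) ∣ γ 1 0) :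
    levelConj p γ h 0 0 = γ 0 0 ∧ levelConj p γ h 0 1 = p * γ 0 1 ∧
      levelConj p γ h 1 0 = γ 1 0 / p ∧ levelConj p γ h 1 1 = γ 1 1 := ⟨rfl, rfl, rfl, rfl⟩

/-- One has `p · γτ = γ'(pτ)` for `γ' = levelConj p γ h`, and `γ'` at `pτ` has the same denominator
`cτ + d`. -/
lemma logEta_level_smul {p : ℕ} (hp : 0 < p) (γ : SL(2, ℤ)) (h : (p : ℤ) ∣ γ 1 0) (τ : ℍ) :
    logEta (p * ((γ • τ : ℍ) : ℂ)) = logEta (p * (τ : ℂ)) +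
      1 / 2 * Complex.log ((γ 1 0 : ℂ) * τ + γ 1 1) + etaConst (levelConj p γ h) := by
  have him : 0 < ((p : ℂ) * τ).im := by
    have : ((p : ℂ) * τ).im = p * τ.im := by simp
    rw [this]
    exact mul_pos (by exact_mod_cast hp) τ.im_pos
  set w : ℍ := ⟨p * τ, him⟩ with hw
  have hwc : (w : ℂ) = p * τ := rfl
  obtain ⟨e00, e01, e10, e11⟩ := levelConj_apply p γ h
  have hpc : (p : ℂ) ≠ 0 := by exact_mod_cast hp.ne'
  have hc : ((γ 1 0 / p : ℤ) : ℂ) = (γ 1 0 : ℂ) / p := by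
    rw [Int.cast_div h (by exact_mod_cast hpc)]
    simp
  have h1 := logEta_smul (levelConj p γ h) w
  rw [coe_smul_int, e00, e01, e10, e11, hwc, hc] at h1
  have h2 : (γ 1 0 : ℂ) / p * (p * τ) + γ 1 1 = (γ 1 0 : ℂ) * τ + γ 1 1 := by
    field_simp
  rw [h2] at h1
  rw [← h1, coe_smul_int]
  congr 1
  push_cast
  ring

/-- The multiplier of the eta-quotient on `γ ∈ Γ₀(p)`, relative to the principal branch. -/
def etaMultiplier (p : ℕ) (r₁ rp : ℚ) (γ : SL(2, ℤ)) (h : (p : ℤ) ∣ γ 1 0) : ℂ :=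
  Complex.exp (r₁ * etaConst γ + rp * etaConst (levelConj p γ h))

lemma etaQuotient_ne_zero (p : ℕ) (r₁ rp : ℚ) (τ : ℍ) : etaQuotient p r₁ rp τ ≠ 0 :=
  mul_ne_zero (Complex.exp_ne_zero _) (Complex.exp_ne_zero _)

lemma etaQuotient_smul {p : ℕ} (hp : 0 < p) (r₁ rp : ℚ) (γ : SL(2, ℤ)) (h : (p : ℤ) ∣ γ 1 0)
    (τ : ℍ) :
    ((γ 1 0 : ℂ) * τ + γ 1 1) ^ (-(((r₁ + rp) / 2 : ℚ) : ℂ)) * etaQuotient p r₁ rp (γ • τ) =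
      etaMultiplier p r₁ rp γ h * etaQuotient p r₁ rp τ := by
  rw [etaQuotient, etaQuotient, etaPow, etaPow, etaPow, etaPow, etaMultiplier,
    logEta_level_smul hp γ h, logEta_smul, Complex.cpow_def_of_ne_zero (denom_int_ne_zero γ τ),
    ← Complex.exp_add, ← Complex.exp_add, ← Complex.exp_add, ← Complex.exp_add]
  congr 1
  push_cast
  ring

lemma autFactor_map (γ : SL(2, ℤ)) (τ : ℍ) :
    autFactor (Matrix.SpecialLinearGroup.map (Int.castRingHom ℝ) γ) τ =
      (γ 1 0 : ℂ) * τ + γ 1 1 := by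
  simp [autFactor]

lemma map_smul (γ : SL(2, ℤ)) (τ : ℍ) :
    Matrix.SpecialLinearGroup.map (Int.castRingHom ℝ) γ • τ = γ • τ := by
  ext
  rw [coe_smul_int, UpperHalfPlane.coe_specialLinearGroup_apply]
  simp

lemma dvd_of_mem_Gamma0 {p : ℕ} {γ : SL(2, ℤ)} (h : γ ∈ CongruenceSubgroup.Gamma0 p) :
    (p : ℤ) ∣ γ 1 0 := by
  rw [CongruenceSubgroup.Gamma0_mem] at h
  exact (ZMod.intCast_zmod_eq_zero_iff_dvd _ _).mp h

lemma mem_Gamma0_of_dvd {p : ℕ} {γ : SL(2, ℤ)} (h : (p : ℤ) ∣ γ 1 0) :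
    γ ∈ CongruenceSubgroup.Gamma0 p := by
  rw [CongruenceSubgroup.Gamma0_mem]
  exact (ZMod.intCast_zmod_eq_zero_iff_dvd _ _).mpr h

lemma slash_etaQuotient {N p : ℕ} (hp : 0 < p) (r₁ rp : ℚ) (g : Cover N) (γ : SL(2, ℤ))
    (h : (p : ℤ) ∣ γ 1 0) (hg : g.mat = Matrix.SpecialLinearGroup.map (Int.castRingHom ℝ) γ) :
    slash ((r₁ + rp) / 2) (etaQuotient p r₁ rp) g =
      (g.eps ^ (-((N : ℂ) * (((r₁ + rp) / 2 : ℚ) : ℂ))) * etaMultiplier p r₁ rp γ h) •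
        etaQuotient p r₁ rp := by
  funext τ
  rw [slash, hg, autFactor_map, map_smul, mul_assoc, etaQuotient_smul hp r₁ rp γ h]
  simp [mul_assoc]

/-- `D` clears the denominators of `r₁`, `rp`, and `24 · πi/12 = 2πi` handles the constants. -/
lemma etaMultiplier_pow (p : ℕ) {r₁ rp : ℚ} {D : ℕ} (hr₁ : ∃ m : ℤ, (D : ℚ) * r₁ = m)
    (hrp : ∃ m : ℤ, (D : ℚ) * rp = m) (γ : SL(2, ℤ)) (h : (p : ℤ) ∣ γ 1 0) :
    etaMultiplier p r₁ rp γ h ^ (24 * D) = 1 := by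
  obtain ⟨m₁, h₁⟩ := hr₁
  obtain ⟨mp, h_p⟩ := hrp
  obtain ⟨n, hn⟩ := exists_etaConst_eq γ
  obtain ⟨n', hn'⟩ := exists_etaConst_eq (levelConj p γ h)
  have h₁' : (D : ℂ) * r₁ = m₁ := by exact_mod_cast h₁
  have h_p' : (D : ℂ) * rp = mp := by exact_mod_cast h_p
  rw [etaMultiplier, ← Complex.exp_nat_mul, Complex.exp_eq_one_iff]
  refine ⟨m₁ * n + mp * n', ?_⟩
  rw [hn, hn']
  push_cast
  rw [← h₁', ← h_p']
  ring

lemma two_mul_weight {r₁ rp : ℚ} {D : ℕ} (hr₁ : ∃ m : ℤ, (D : ℚ) * r₁ = m)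
    (hrp : ∃ m : ℤ, (D : ℚ) * rp = m) :
    ∃ m : ℤ, ((2 * D : ℕ) : ℚ) * ((r₁ + rp) / 2) = m := by
  obtain ⟨m₁, h₁⟩ := hr₁
  obtain ⟨mp, h_p⟩ := hrp
  refine ⟨m₁ + mp, ?_⟩
  push_cast
  rw [← h₁, ← h_p]
  ring

section

variable {p : ℕ} [Fact p.Prime] {r₁ rp : ℚ} {D : ℕ} [NeZero D]

lemma existsUnique_etaCharacter (hr₁ : ∃ m : ℤ, (D : ℚ) * r₁ = m)
    (hrp : ∃ m : ℤ, (D : ℚ) * rp = m) :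
    ∃! χ : Cover.preimage (2 * D) (CongruenceSubgroup.Gamma0 p) →* ℂˣ,
      HasMultiplier ((r₁ + rp) / 2) (etaQuotient p r₁ rp) χ := by
  refine existsUnique_hasMultiplier (two_mul_weight hr₁ hrp) (etaQuotient_ne_zero p r₁ rp) ?_
  rintro g ⟨γ, hγ, hg⟩
  exact ⟨_, slash_etaQuotient (Fact.out : p.Prime).pos r₁ rp g γ (dvd_of_mem_Gamma0 hγ) hg.symm⟩

lemma HasMultiplier.eta_apply {χ : Cover.preimage (2 * D) (CongruenceSubgroup.Gamma0 p) →* ℂˣ}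
    (hχ : HasMultiplier ((r₁ + rp) / 2) (etaQuotient p r₁ rp) χ)
    (g : Cover.preimage (2 * D) (CongruenceSubgroup.Gamma0 p)) (γ : SL(2, ℤ))
    (h : (p : ℤ) ∣ γ 1 0)
    (hg : (g : Cover (2 * D)).mat = Matrix.SpecialLinearGroup.map (Int.castRingHom ℝ) γ) :
    (χ g : ℂ) = (g : Cover (2 * D)).eps ^ (-(((2 * D : ℕ) : ℂ) * (((r₁ + rp) / 2 : ℚ) : ℂ))) *
      etaMultiplier p r₁ rp γ h := by
  have h1 := hχ g
  rw [slash_etaQuotient (Fact.out : p.Prime).pos r₁ rp (g : Cover (2 * D)) γ h hg] at h1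
  have h2 := congrFun h1 UpperHalfPlane.I
  simp only [Pi.smul_apply, smul_eq_mul] at h2
  exact (mul_right_cancel₀ (etaQuotient_ne_zero p r₁ rp _) h2).symm

lemma HasMultiplier.eta_pow (hr₁ : ∃ m : ℤ, (D : ℚ) * r₁ = m)
    (hrp : ∃ m : ℤ, (D : ℚ) * rp = m)
    {χ : Cover.preimage (2 * D) (CongruenceSubgroup.Gamma0 p) →* ℂˣ}
    (hχ : HasMultiplier ((r₁ + rp) / 2) (etaQuotient p r₁ rp) χ)
    (g : Cover.preimage (2 * D) (CongruenceSubgroup.Gamma0 p)) : χ g ^ (24 * D) = 1 := by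
  obtain ⟨γ, hγ, hg⟩ := g.2
  obtain ⟨m, hm⟩ := two_mul_weight hr₁ hrp
  have hm' : ((2 * D : ℕ) : ℂ) * (((r₁ + rp) / 2 : ℚ) : ℂ) = m := by exact_mod_cast hm
  ext
  rw [Units.val_pow_eq_pow_val, hχ.eta_apply g γ (dvd_of_mem_Gamma0 hγ) hg.symm, mul_pow,
    etaMultiplier_pow p hr₁ hrp, hm', ← Int.cast_neg, Complex.cpow_intCast, ← zpow_natCast,
    ← zpow_mul, mul_comm (-m), zpow_mul, zpow_natCast, show 24 * D = 2 * D * 12 by ring, pow_mul,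
    (g : Cover (2 * D)).eps_pow]
  simp

lemma HasMultiplier.eta_norm (hr₁ : ∃ m : ℤ, (D : ℚ) * r₁ = m)
    (hrp : ∃ m : ℤ, (D : ℚ) * rp = m)
    {χ : Cover.preimage (2 * D) (CongruenceSubgroup.Gamma0 p) →* ℂˣ}
    (hχ : HasMultiplier ((r₁ + rp) / 2) (etaQuotient p r₁ rp) χ)
    (g : Cover.preimage (2 * D) (CongruenceSubgroup.Gamma0 p)) : ‖(χ g : ℂ)‖ = 1 := by
  refine Complex.norm_eq_one_of_pow_eq_one (n := 24 * D) ?_ (by simp [NeZero.ne D])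
  rw [← Units.val_pow_eq_pow_val, hχ.eta_pow hr₁ hrp, Units.val_one]

/-- The image lies in the finite group of `24 D`-th roots of unity. -/
lemma HasMultiplier.eta_finiteIndex_ker (hr₁ : ∃ m : ℤ, (D : ℚ) * r₁ = m)
    (hrp : ∃ m : ℤ, (D : ℚ) * rp = m)
    {χ : Cover.preimage (2 * D) (CongruenceSubgroup.Gamma0 p) →* ℂˣ}
    (hχ : HasMultiplier ((r₁ + rp) / 2) (etaQuotient p r₁ rp) χ) : χ.ker.FiniteIndex := by
  have : NeZero (24 * D) := ⟨by simp [NeZero.ne D]⟩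
  have hle : χ.range ≤ rootsOfUnity (24 * D) ℂ := by
    rintro _ ⟨g, rfl⟩
    exact hχ.eta_pow hr₁ hrp g
  have hfin : Finite χ.range := Finite.of_injective _ (Subgroup.inclusion_injective hle)
  exact Subgroup.finiteIndex_ker χ

end

/-- Links the explicit series with the character: the Dedekind sum formula is applied to `γ` and to
its conjugate of lower left entry `c / p`. -/
lemma eisCoeff_eq {p : ℕ} (hp : 0 < p) (r₁ rp : ℚ) (γ : SL(2, ℤ)) (h : (p : ℤ) ∣ γ 1 0)
    (hc : 0 < γ 1 0) :
    eisCoeff p r₁ rp (γ 0 0) (γ 1 0) (γ 1 1) = (etaMultiplier p r₁ rp γ h)⁻¹ := by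
  obtain ⟨e00, e01, e10, e11⟩ := levelConj_apply p γ h
  have hpz : (0 : ℤ) < p := by exact_mod_cast hp
  have hc' : 0 < γ 1 0 / (p : ℤ) := Int.ediv_pos_of_pos_of_dvd hc hpz.le h
  rw [etaMultiplier, etaConst_eq_dedekindSum γ hc,
    etaConst_eq_dedekindSum (levelConj p γ h) (by rw [e10]; exact hc'), e00, e10, e11,
    ← Complex.exp_neg, eisCoeff, expTwoPiI]
  congr 1
  have hcast : ((γ 1 0 / p : ℤ) : ℚ) = (γ 1 0 : ℚ) / p := by
    rw [Int.cast_div h (by exact_mod_cast hp.ne')]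
    simp
  rw [hcast]
  generalize dedekindSum (-γ 1 1) (γ 1 0) = s₁
  generalize dedekindSum (-γ 1 1) (γ 1 0 / p) = s₂
  have hcq : (γ 1 0 : ℂ) ≠ 0 := by exact_mod_cast hc.ne'
  have hpq : (p : ℂ) ≠ 0 := by exact_mod_cast hp.ne'
  push_cast
  field_simp
  ring

/-! ### Lattice sums of real weight -/

/-- The action of `SL(2, ℤ)` on row vectors. -/
def rowEquiv (δ : SL(2, ℤ)) : (Fin 2 → ℤ) ≃ (Fin 2 → ℤ) where
  toFun v := Matrix.vecMul v δ
  invFun v := Matrix.vecMul v (δ⁻¹ : SL(2, ℤ))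
  left_inv v := by
    change Matrix.vecMul (Matrix.vecMul v (δ : Matrix (Fin 2) (Fin 2) ℤ))
      ((δ⁻¹ : SL(2, ℤ)) : Matrix (Fin 2) (Fin 2) ℤ) = v
    rw [Matrix.vecMul_vecMul, ← Matrix.SpecialLinearGroup.coe_mul, mul_inv_cancel]
    simp
  right_inv v := by
    change Matrix.vecMul (Matrix.vecMul v ((δ⁻¹ : SL(2, ℤ)) : Matrix (Fin 2) (Fin 2) ℤ))
      (δ : Matrix (Fin 2) (Fin 2) ℤ) = v
    rw [Matrix.vecMul_vecMul, ← Matrix.SpecialLinearGroup.coe_mul, inv_mul_cancel]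
    simp

lemma rowEquiv_apply (δ : SL(2, ℤ)) (v : Fin 2 → ℤ) (j : Fin 2) :
    rowEquiv δ v j = v 0 * δ 0 j + v 1 * δ 1 j := by
  simp [rowEquiv, Matrix.vecMul, dotProduct, Fin.sum_univ_two]

/-- The linear form `c τ + d` of a row `(c, d)`. -/
def rowForm (v : Fin 2 → ℤ) (τ : ℍ) : ℂ := (v 0 : ℂ) * τ + v 1

lemma rowForm_rowEquiv (δ : SL(2, ℤ)) (v : Fin 2 → ℤ) (τ : ℍ) :
    rowForm (rowEquiv δ v) τ = rowForm v (δ • τ) * ((δ 1 0 : ℂ) * τ + δ 1 1) := by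
  have h := denom_int_ne_zero δ τ
  rw [rowForm, rowForm, rowEquiv_apply, rowEquiv_apply, coe_smul_int]
  push_cast
  field_simp
  ring

lemma summable_rowForm {k : ℝ} (hk : 2 < k) (τ : ℍ) :
    Summable fun v : Fin 2 → ℤ => ‖rowForm v τ‖ ^ (-k) :=
  Summable.of_nonneg_of_le (fun _ => by positivity)
    (fun v => EisensteinSeries.summand_bound τ (by linarith) v)
    ((EisensteinSeries.summable_one_div_norm_rpow hk).mul_left _)

/-- The sum of `|c τ + d|^{-k}` over the rows with `c ≠ 0`. -/
def rowSum (k : ℝ) (τ : ℍ) : ℝ :=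
  ∑' v : Fin 2 → ℤ, if v 0 = 0 then 0 else ‖rowForm v τ‖ ^ (-k)

lemma summable_rowSum {k : ℝ} (hk : 2 < k) (τ : ℍ) :
    Summable fun v : Fin 2 → ℤ => if v 0 = 0 then 0 else ‖rowForm v τ‖ ^ (-k) := by
  refine Summable.of_nonneg_of_le (fun v => ?_) (fun v => ?_) (summable_rowForm hk τ)
  · split_ifs <;> positivity
  · split_ifs
    · positivity
    · exact le_rfl

/-- `T^n` permutes the rows by `(c, d) ↦ (c, d + n c)` and so preserves the condition `c ≠ 0`. -/
lemma rowSum_T_zpow (k : ℝ) (n : ℤ) (τ : ℍ) : rowSum k (ModularGroup.T ^ n • τ) = rowSum k τ := by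
  unfold rowSum
  conv_rhs => rw [← (rowEquiv (ModularGroup.T ^ n)).tsum_eq]
  refine tsum_congr fun v => ?_
  rw [rowForm_rowEquiv, rowEquiv_apply, ModularGroup.coe_T_zpow]
  simp

/-- Dominated convergence: a term with `c ≠ 0` is at most `(Im τ)^{-k}`. The uniform majorant is
available only on a vertical strip, so `τ` is first translated to have real part in `[0, 1)`. -/
lemma tendsto_rowSum {k : ℝ} (hk : 2 < k) :
    Filter.Tendsto (rowSum k) UpperHalfPlane.atImInfty (nhds 0) := by
  set s : ℍ → ℍ := fun τ => ModularGroup.T ^ (-⌊τ.re⌋) • τ with hs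
  have hre : ∀ τ, (s τ).re = τ.re - ⌊τ.re⌋ := by
    intro τ
    rw [hs]
    simp only [ModularGroup.re_T_zpow_smul]
    push_cast
    ring
  have him : ∀ τ, (s τ).im = τ.im := by
    intro τ
    rw [hs]
    simp only [ModularGroup.im_T_zpow_smul]
  have hsum : rowSum k = fun τ => rowSum k (s τ) := by
    funext τ
    rw [hs, rowSum_T_zpow]
  rw [hsum]
  have h0 : nhds (0 : ℝ) = nhds (∑' _ : Fin 2 → ℤ, (0 : ℝ)) := by rw [tsum_zero]
  unfold rowSum
  rw [h0]
  have hpos : (0 : ℝ) < 1 := one_pos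
  refine tendsto_tsum_of_dominated_convergence
    (bound := fun v => EisensteinSeries.r ⟨⟨1, 1⟩, hpos⟩ ^ (-k) * ‖v‖ ^ (-k))
    ((EisensteinSeries.summable_one_div_norm_rpow hk).mul_left _) (fun v => ?_) ?_
  · by_cases hv : v 0 = 0
    · simp [hv]
    · simp only [hv, if_false]
      have h1 : Filter.Tendsto (fun τ : ℍ => τ.im ^ (-k)) UpperHalfPlane.atImInfty (nhds 0) :=
        (tendsto_rpow_neg_atTop (by linarith : 0 < k)).comp Filter.tendsto_comap
      refine squeeze_zero (fun τ => by positivity) (fun τ => ?_) h1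
      refine Real.rpow_le_rpow_of_nonpos τ.im_pos ?_ (by linarith)
      have h2 := Complex.abs_im_le_norm (rowForm v (s τ))
      have h3 : (rowForm v (s τ)).im = v 0 * τ.im := by
        simp [rowForm, him]
      rw [h3, abs_mul, abs_of_pos τ.im_pos] at h2
      have h4 : (1 : ℝ) ≤ |(v 0 : ℝ)| := by exact_mod_cast Int.one_le_abs hv
      nlinarith [τ.im_pos]
  · have hev : ∀ᶠ τ : ℍ in UpperHalfPlane.atImInfty, 1 ≤ τ.im :=
      UpperHalfPlane.atImInfty_mem _ |>.mpr ⟨1, fun z hz => hz⟩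
    filter_upwards [hev] with τ hτ v
    have hstrip : s τ ∈ UpperHalfPlane.verticalStrip 1 1 := by
      refine ⟨?_, ?_⟩
      · rw [hre, Int.self_sub_floor, abs_of_nonneg (Int.fract_nonneg _)]
        exact (Int.fract_lt_one _).le
      · rw [him]
        exact hτ
    have hb := EisensteinSeries.summand_bound_of_mem_verticalStrip (by linarith : 0 ≤ k) v hpos
      hstrip
    split_ifs
    · rw [norm_zero]
      have := EisensteinSeries.r_pos ⟨⟨1, 1⟩, hpos⟩
      positivity
    · rw [Real.norm_of_nonneg (by positivity)]
      exact hb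

/-- A series bounded by `∑ |c τ + d|^{-k}` whose terms with `c = 0` are constant has a limit as
`Im τ → ∞`. -/
lemma exists_tendsto_tsum_row {k : ℝ} (hk : 2 < k) (B : (Fin 2 → ℤ) → ℍ → ℂ)
    (hb : ∀ v τ, ‖B v τ‖ ≤ ‖rowForm v τ‖ ^ (-k))
    (hc : ∀ v, v 0 = 0 → ∀ τ τ', B v τ = B v τ') :
    ∃ L : ℂ, Filter.Tendsto (fun τ => ∑' v, B v τ) UpperHalfPlane.atImInfty (nhds L) := by
  have hS₀ : ∀ τ, Summable fun v => if v 0 = 0 then B v τ else 0 := fun τ => by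
    refine Summable.of_norm_bounded (summable_rowForm hk τ) fun v => ?_
    split_ifs
    · exact hb v τ
    · rw [norm_zero]
      positivity
  have hb₁ : ∀ τ v, ‖if v 0 = 0 then 0 else B v τ‖ ≤
      if v 0 = 0 then 0 else ‖rowForm v τ‖ ^ (-k) := by
    intro τ v
    split_ifs
    · rw [norm_zero]
    · exact hb v τ
  have hS₁ : ∀ τ, Summable fun v => if v 0 = 0 then 0 else B v τ := fun τ =>
    Summable.of_norm_bounded (summable_rowSum hk τ) (hb₁ τ)
  have hle : ∀ τ, ‖∑' v, if v 0 = 0 then 0 else B v τ‖ ≤ rowSum k τ := fun τ =>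
    tsum_of_norm_bounded (summable_rowSum hk τ).hasSum (hb₁ τ)
  have hlim := (tendsto_const_nhds
    (x := ∑' v, if v 0 = 0 then B v UpperHalfPlane.I else 0)).add
    (squeeze_zero_norm hle (tendsto_rowSum hk))
  refine ⟨_, hlim.congr fun τ => ?_⟩
  have e : ∑' v, (if v 0 = 0 then B v UpperHalfPlane.I else 0) =
      ∑' v, if v 0 = 0 then B v τ else 0 := by
    refine tsum_congr fun v => ?_
    split_ifs with hv
    · exact hc v hv _ _
    · rfl
  rw [e, ← (hS₀ τ).tsum_add (hS₁ τ)]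
  refine tsum_congr fun v => ?_
  split_ifs <;> simp

/-! ### Poincaré series -/

/-- The bottom row of the matrix of `g` is `v`. -/
def HasRow {N : ℕ} (g : Cover N) (v : Fin 2 → ℤ) : Prop :=
  g.mat 1 0 = v 0 ∧ g.mat 1 1 = v 1

lemma HasRow.autFactor_eq {N : ℕ} {g : Cover N} {v : Fin 2 → ℤ} (h : HasRow g v) (τ : ℍ) :
    autFactor g.mat τ = rowForm v τ := by
  rw [autFactor, h.1, h.2, rowForm]
  push_cast
  rfl

lemma autFactor_eq_of_apply_eq_zero {m : SL(2, ℝ)} (h : m 1 0 = 0) (τ τ' : ℍ) :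
    autFactor m τ = autFactor m τ' := by
  simp [autFactor, h]

lemma slashFactor_eq_of_apply_eq_zero {N : ℕ} (k : ℚ) {g : Cover N} (h : g.mat 1 0 = 0)
    (τ τ' : ℍ) : slashFactor k g τ = slashFactor k g τ' := by
  rw [slashFactor, slashFactor, autFactor_eq_of_apply_eq_zero h τ τ']

lemma differentiableAt_slashFactor {N : ℕ} (k : ℚ) (g : Cover N) {z : ℂ} (hz : 0 < z.im) :
    DifferentiableAt ℂ (fun z => slashFactor k g (UpperHalfPlane.ofComplex z)) z := by
  have hev : (fun z => slashFactor k g (UpperHalfPlane.ofComplex z)) =ᶠ[nhds z] fun z =>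
      g.eps ^ (-((N : ℂ) * (k : ℂ))) *
        ((g.mat 1 0 : ℂ) * z + (g.mat 1 1 : ℂ)) ^ (-(k : ℂ)) := by
    filter_upwards [UpperHalfPlane.isOpen_upperHalfPlaneSet.mem_nhds hz] with w hw
    rw [slashFactor, autFactor, UpperHalfPlane.ofComplex_apply_of_im_pos hw]
  refine DifferentiableAt.congr_of_eventuallyEq ?_ hev
  by_cases hc : g.mat 1 0 = 0
  · simp only [hc, Complex.ofReal_zero, zero_mul, zero_add]
    exact differentiableAt_const _
  · refine DifferentiableAt.const_mul (DifferentiableAt.cpow (by fun_prop) (by fun_prop) ?_) _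
    refine Complex.mem_slitPlane_iff.mpr (Or.inr ?_)
    have : ((g.mat 1 0 : ℂ) * z + (g.mat 1 1 : ℂ)).im = g.mat 1 0 * z.im := by simp
    rw [this]
    exact mul_ne_zero hc hz.ne'

section

variable {N : ℕ} [NeZero N]

lemma HasRow.mul {g h : Cover N} {v : Fin 2 → ℤ} {δ : SL(2, ℤ)} (hg : HasRow g v)
    (hh : h.mat = Matrix.SpecialLinearGroup.map (Int.castRingHom ℝ) δ) :
    HasRow (g * h) (rowEquiv δ v) := by
  have e : (g * h).mat = g.mat * h.mat := rfl
  constructor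
  · rw [e, hh, rowEquiv_apply, Matrix.SpecialLinearGroup.coe_mul, Matrix.mul_apply,
      Fin.sum_univ_two, hg.1, hg.2]
    simp
  · rw [e, hh, rowEquiv_apply, Matrix.SpecialLinearGroup.coe_mul, Matrix.mul_apply,
      Fin.sum_univ_two, hg.1, hg.2]
    simp

/-- Elements with the same bottom row up to sign differ by a left factor fixing i∞. -/
lemma mul_inv_apply_eq_zero {g g' : Cover N} {v : Fin 2 → ℤ} (hg : HasRow g v)
    (hg' : HasRow g' v ∨ HasRow g' (-v)) : (g' * g⁻¹).mat 1 0 = 0 := by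
  have e : (g' * g⁻¹).mat = g'.mat * g.mat⁻¹ := rfl
  rw [e, Matrix.SpecialLinearGroup.coe_mul, Matrix.SpecialLinearGroup.coe_inv,
    Matrix.adjugate_fin_two, Matrix.mul_apply, Fin.sum_univ_two]
  rcases hg' with h | h <;> rw [h.1, h.2] <;> simp [hg.1, hg.2] <;> ring

variable {G : Subgroup SL(2, ℤ)}

/-- The data of a Poincaré series at the cusp `s ∞`: a unitary character `χ` that agrees with the
automorphy factor of weight `k` on the stabilizer of the cusp. -/
structure CuspCharacter (k : ℚ) (χ : Cover.preimage N G →* ℂˣ) (s : Cover N) : Prop where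
  weight : ∃ m : ℤ, (N : ℚ) * k = m
  two_lt : 2 < k
  norm_eq_one : ∀ g, ‖(χ g : ℂ)‖ = 1
  stabilizer : ∀ (n : Cover N) (h : s * n * s⁻¹ ∈ Cover.preimage N G), n.mat 1 0 = 0 →
    ∀ τ, (χ ⟨s * n * s⁻¹, h⟩ : ℂ) = slashFactor k n τ

open Classical in
/-- The term `χ(s g)⁻¹ (1|_k g)` of a Poincaré series, where `g` has bottom row `v`. -/
def poincareTerm (k : ℚ) (χ : Cover.preimage N G →* ℂˣ) (s : Cover N) (v : Fin 2 → ℤ) (τ : ℍ) :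
    ℂ :=
  if h : ∃ g : Cover N, s * g ∈ Cover.preimage N G ∧ HasRow g v then
    (χ ⟨s * h.choose, h.choose_spec.1⟩ : ℂ)⁻¹ * slashFactor k h.choose τ
  else 0

/-- The Poincaré series of weight `k` at the cusp `s ∞`. -/
def poincare (k : ℚ) (χ : Cover.preimage N G →* ℂˣ) (s : Cover N) (τ : ℍ) : ℂ :=
  ∑' v : Fin 2 → ℤ, poincareTerm k χ s v τ

variable {k : ℚ} {χ : Cover.preimage N G →* ℂˣ} {s : Cover N}

/-- With `g' = n g` and `n` fixing i∞, the factor of `n` and `χ(s n s⁻¹)⁻¹` cancel. Allowing the row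
`-v` also yields the symmetry of the series under sign change. -/
lemma CuspCharacter.inv_mul_eq (H : CuspCharacter k χ s) {g g' : Cover N} {v : Fin 2 → ℤ}
    (hg : s * g ∈ Cover.preimage N G) (hg' : s * g' ∈ Cover.preimage N G) (hv : HasRow g v)
    (hv' : HasRow g' v ∨ HasRow g' (-v)) (τ : ℍ) :
    (χ ⟨s * g, hg⟩ : ℂ)⁻¹ * slashFactor k g τ = (χ ⟨s * g', hg'⟩ : ℂ)⁻¹ * slashFactor k g' τ := by
  have e1 : s * (g' * g⁻¹) * s⁻¹ = (s * g') * (s * g)⁻¹ := by group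
  have hmem : s * (g' * g⁻¹) * s⁻¹ ∈ Cover.preimage N G := by
    rw [e1]
    exact mul_mem hg' (inv_mem hg)
  have h1 := H.stabilizer (g' * g⁻¹) hmem (mul_inv_apply_eq_zero hv hv') (g.mat • τ)
  have h2 : slashFactor k g' τ = slashFactor k (g' * g⁻¹) (g.mat • τ) * slashFactor k g τ := by
    rw [← slashFactor_mul H.weight, inv_mul_cancel_right]
  have h3 : χ ⟨s * g', hg'⟩ = χ ⟨s * (g' * g⁻¹) * s⁻¹, hmem⟩ * χ ⟨s * g, hg⟩ := by
    rw [← map_mul]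
    congr 1
    ext1
    simp only [Subgroup.coe_mul]
    group
  rw [h2, h3, ← h1, Units.val_mul]
  have := (χ ⟨s * (g' * g⁻¹) * s⁻¹, hmem⟩).ne_zero
  have := (χ ⟨s * g, hg⟩).ne_zero
  field_simp

lemma CuspCharacter.poincareTerm_eq (H : CuspCharacter k χ s) {g : Cover N} {v : Fin 2 → ℤ}
    (hg : s * g ∈ Cover.preimage N G) (hv : HasRow g v) (τ : ℍ) :
    poincareTerm k χ s v τ = (χ ⟨s * g, hg⟩ : ℂ)⁻¹ * slashFactor k g τ := by
  have h : ∃ g : Cover N, s * g ∈ Cover.preimage N G ∧ HasRow g v := ⟨g, hg, hv⟩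
  rw [poincareTerm, dif_pos h]
  exact H.inv_mul_eq _ hg h.choose_spec.2 (Or.inl hv) τ

lemma poincareTerm_eq_zero {v : Fin 2 → ℤ}
    (h : ¬ ∃ g : Cover N, s * g ∈ Cover.preimage N G ∧ HasRow g v) (τ : ℍ) :
    poincareTerm k χ s v τ = 0 := by
  rw [poincareTerm, dif_neg h]

lemma CuspCharacter.norm_poincareTerm_le (H : CuspCharacter k χ s) (v : Fin 2 → ℤ) (τ : ℍ) :
    ‖poincareTerm k χ s v τ‖ ≤ ‖rowForm v τ‖ ^ (-(k : ℝ)) := by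
  by_cases h : ∃ g : Cover N, s * g ∈ Cover.preimage N G ∧ HasRow g v
  · obtain ⟨g, hg, hv⟩ := h
    rw [H.poincareTerm_eq hg hv, norm_mul, norm_inv, H.norm_eq_one, norm_slashFactor H.weight,
      hv.autFactor_eq]
    simp
  · rw [poincareTerm_eq_zero h, norm_zero]
    positivity

lemma CuspCharacter.two_lt_real (H : CuspCharacter k χ s) : (2 : ℝ) < k := by
  exact_mod_cast H.two_lt

lemma CuspCharacter.summable_poincareTerm (H : CuspCharacter k χ s) (τ : ℍ) :
    Summable fun v => poincareTerm k χ s v τ :=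
  Summable.of_norm_bounded (summable_rowForm H.two_lt_real τ)
    fun v => H.norm_poincareTerm_le v τ

/-- Slashing by `h` replaces `g` by `g h`, and `χ(s g)⁻¹ = χ(h) χ(s g h)⁻¹`. Rows that do not occur
are preserved, as one sees by multiplying with `h⁻¹`. -/
lemma CuspCharacter.slash_poincareTerm (H : CuspCharacter k χ s) (h : Cover.preimage N G)
    {δ : SL(2, ℤ)} (hδ : (h : Cover N).mat = Matrix.SpecialLinearGroup.map (Int.castRingHom ℝ) δ)
    (v : Fin 2 → ℤ) (τ : ℍ) :
    slash k (poincareTerm k χ s v) (h : Cover N) τ =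
      χ h * poincareTerm k χ s (rowEquiv δ v) τ := by
  rw [slash_apply]
  by_cases hex : ∃ g : Cover N, s * g ∈ Cover.preimage N G ∧ HasRow g v
  · obtain ⟨g, hg, hv⟩ := hex
    have hgh : s * (g * h) ∈ Cover.preimage N G := by
      rw [← mul_assoc]
      exact mul_mem hg h.2
    rw [H.poincareTerm_eq hg hv, H.poincareTerm_eq hgh (hv.mul hδ), slashFactor_mul H.weight]
    have e : χ ⟨s * (g * h), hgh⟩ = χ ⟨s * g, hg⟩ * χ h := by
      rw [← map_mul]
      congr 1
      ext1
      simp [mul_assoc]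
    rw [e, Units.val_mul]
    have := (χ ⟨s * g, hg⟩).ne_zero
    have := (χ h).ne_zero
    field_simp
  · rw [poincareTerm_eq_zero hex, poincareTerm_eq_zero]
    · simp
    · rintro ⟨g, hg, hv⟩
      refine hex ⟨g * (h : Cover N)⁻¹, ?_, ?_⟩
      · rw [← mul_assoc]
        exact mul_mem hg (inv_mem h.2)
      · have hinv : ((h : Cover N)⁻¹).mat =
            Matrix.SpecialLinearGroup.map (Int.castRingHom ℝ) δ⁻¹ := by
          rw [map_inv, ← hδ]
          rfl
        have := hv.mul hinv
        rwa [show rowEquiv δ⁻¹ (rowEquiv δ v) = v from (rowEquiv δ).symm_apply_apply v] at this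

lemma slash_poincare (k : ℚ) (χ : Cover.preimage N G →* ℂˣ) (s h : Cover N) (τ : ℍ) :
    slash k (poincare k χ s) h τ = ∑' v, slash k (poincareTerm k χ s v) h τ := by
  simp only [slash_apply, poincare, tsum_mul_left]

lemma CuspCharacter.hasMultiplier_poincare (H : CuspCharacter k χ s) :
    HasMultiplier k (poincare k χ s) χ := by
  intro h
  obtain ⟨δ, -, hδ⟩ := h.2
  funext τ
  rw [slash_poincare, Pi.smul_apply, smul_eq_mul, poincare,
    ← (rowEquiv δ).tsum_eq (fun v => poincareTerm k χ s v τ), ← tsum_mul_left]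
  exact tsum_congr fun v => H.slash_poincareTerm h hδ.symm v τ

lemma CuspCharacter.norm_slash_poincareTerm_le (H : CuspCharacter k χ s) {h : Cover N}
    {δ : SL(2, ℤ)} (hδ : h.mat = Matrix.SpecialLinearGroup.map (Int.castRingHom ℝ) δ)
    (v : Fin 2 → ℤ) (τ : ℍ) :
    ‖slash k (poincareTerm k χ s v) h τ‖ ≤ ‖rowForm (rowEquiv δ v) τ‖ ^ (-(k : ℝ)) := by
  rw [slash_apply, norm_mul, norm_slashFactor H.weight, hδ, autFactor_map, map_smul,
    rowForm_rowEquiv, norm_mul, Real.mul_rpow (norm_nonneg _) (norm_nonneg _), mul_comm]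
  gcongr
  exact H.norm_poincareTerm_le v _

lemma CuspCharacter.slash_poincareTerm_const (H : CuspCharacter k χ s) {h : Cover N}
    {δ : SL(2, ℤ)} (hδ : h.mat = Matrix.SpecialLinearGroup.map (Int.castRingHom ℝ) δ)
    {v : Fin 2 → ℤ} (hv : rowEquiv δ v 0 = 0) (τ τ' : ℍ) :
    slash k (poincareTerm k χ s v) h τ = slash k (poincareTerm k χ s v) h τ' := by
  rw [slash_apply, slash_apply]
  by_cases hex : ∃ g : Cover N, s * g ∈ Cover.preimage N G ∧ HasRow g v
  · obtain ⟨g, hg, hrow⟩ := hex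
    rw [H.poincareTerm_eq hg hrow, H.poincareTerm_eq hg hrow, mul_left_comm,
      mul_left_comm (slashFactor k h τ'), mul_comm (slashFactor k h τ),
      mul_comm (slashFactor k h τ'), ← slashFactor_mul H.weight, ← slashFactor_mul H.weight,
      slashFactor_eq_of_apply_eq_zero k (g := g * h) (by rw [(hrow.mul hδ).1, hv]; simp) τ τ']
  · rw [poincareTerm_eq_zero hex, poincareTerm_eq_zero hex]
    simp

/-- After reindexing by the row of `g h`, the terms satisfy the bound of the lattice sum, and those
whose new row has `c = 0` are constant, so `exists_tendsto_tsum_row` applies. -/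
lemma CuspCharacter.exists_tendsto_slash (H : CuspCharacter k χ s) {h : Cover N}
    (hh : h ∈ Cover.preimage N (⊤ : Subgroup SL(2, ℤ))) :
    ∃ L : ℂ, Filter.Tendsto (slash k (poincare k χ s) h) UpperHalfPlane.atImInfty (nhds L) := by
  obtain ⟨δ, -, hδ⟩ := hh
  replace hδ : h.mat = Matrix.SpecialLinearGroup.map (Int.castRingHom ℝ) δ := hδ.symm
  obtain ⟨L, hL⟩ := exists_tendsto_tsum_row H.two_lt_real
    (fun v τ => slash k (poincareTerm k χ s ((rowEquiv δ).symm v)) h τ)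
    (fun v τ => by
      simpa only [Equiv.apply_symm_apply] using
        H.norm_slash_poincareTerm_le hδ ((rowEquiv δ).symm v) τ)
    (fun v hv τ τ' => H.slash_poincareTerm_const hδ
      (by rw [Equiv.apply_symm_apply]; exact hv) τ τ')
  refine ⟨L, hL.congr fun τ => ?_⟩
  rw [slash_poincare]
  exact (rowEquiv δ).symm.tsum_eq fun v => slash k (poincareTerm k χ s v) h τ

lemma differentiableAt_poincareTerm (k : ℚ) (χ : Cover.preimage N G →* ℂˣ) (s : Cover N)
    (v : Fin 2 → ℤ) {z : ℂ} (hz : 0 < z.im) :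
    DifferentiableAt ℂ (fun z => poincareTerm k χ s v (UpperHalfPlane.ofComplex z)) z := by
  unfold poincareTerm
  split_ifs with h
  · exact (differentiableAt_slashFactor k _ hz).const_mul _
  · exact differentiableAt_const _

lemma CuspCharacter.mdifferentiable_poincare (H : CuspCharacter k χ s) :
    MDifferentiable (modelWithCornersSelf ℂ ℂ) (modelWithCornersSelf ℂ ℂ) (poincare k χ s) := by
  rw [UpperHalfPlane.mdifferentiable_iff]
  intro z hz
  refine DifferentiableAt.differentiableWithinAt ?_
  have hB : 0 < z.im / 2 := half_pos hz
  -- A neighbourhood with bounded real part and imaginary part bounded below lies in a vertical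
  -- strip, where the series has a summable majorant independent of the point.
  set U : Set ℂ := {w | |w.re| < |z.re| + 1 ∧ z.im / 2 < w.im} with hU
  have hUo : IsOpen U := by
    exact (isOpen_lt Complex.continuous_re.abs continuous_const).inter
      (isOpen_lt continuous_const Complex.continuous_im)
  have hzU : z ∈ U := ⟨by linarith, half_lt_self hz⟩
  have hd : DifferentiableOn ℂ
      (fun w => ∑' v, poincareTerm k χ s v (UpperHalfPlane.ofComplex w)) U := by
    refine Complex.differentiableOn_tsum_of_summable_norm
      (u := fun v => EisensteinSeries.r ⟨⟨|z.re| + 1, z.im / 2⟩, hB⟩ ^ (-(k : ℝ)) *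
        ‖v‖ ^ (-(k : ℝ)))
      ((EisensteinSeries.summable_one_div_norm_rpow H.two_lt_real).mul_left _) (fun v w hw => ?_)
      hUo (fun v w hw => ?_)
    · exact (differentiableAt_poincareTerm k χ s v (hB.trans hw.2)).differentiableWithinAt
    · refine (H.norm_poincareTerm_le v _).trans ?_
      have hw0 : 0 < w.im := hB.trans hw.2
      refine EisensteinSeries.summand_bound_of_mem_verticalStrip
        (by linarith [H.two_lt_real]) v hB ?_
      rw [UpperHalfPlane.ofComplex_apply_of_im_pos hw0]
      exact ⟨hw.1.le, hw.2.le⟩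
  exact (hd z hzU).differentiableAt (hUo.mem_nhds hzU)

/-- Poincaré series are modular forms. -/
theorem CuspCharacter.poincare_mem (H : CuspCharacter k χ s) :
    poincare k χ s ∈ modularForms k χ :=
  ⟨H.mdifferentiable_poincare, H.hasMultiplier_poincare, fun _ h => H.exists_tendsto_slash h⟩

end

/-! ### The eta-quotient at the cusps -/

lemma logEta_add_int {z : ℂ} (hz : 0 < z.im) (m : ℤ) :
    logEta (z + m) = logEta z + m * (Real.pi * Complex.I / 12) := by
  have h := logEta_smul (ModularGroup.T ^ m) ⟨z, hz⟩
  have h2 := etaConst_mul_T_zpow 1 m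
  rw [one_mul, etaConst_one, zero_add] at h2
  rw [h2, coe_smul_int, ModularGroup.coe_T_zpow] at h
  simpa using h

lemma etaQuotient_translate {p : ℕ} (hp : 0 < p) (r₁ rp : ℚ) {τ τ' : ℍ} {m : ℤ}
    (h : (τ' : ℂ) = τ + m) :
    etaQuotient p r₁ rp τ' =
      Complex.exp (2 * Real.pi * Complex.I * (m * ((r₁ + p * rp) / 24 : ℚ))) *
        etaQuotient p r₁ rp τ := by
  have him : 0 < ((p : ℂ) * τ).im := by
    have : ((p : ℂ) * τ).im = p * τ.im := by simp
    rw [this]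
    exact mul_pos (by exact_mod_cast hp) τ.im_pos
  have h2 : (p : ℂ) * (τ + m) = p * τ + ((p * m : ℤ) : ℂ) := by
    push_cast
    ring
  rw [etaQuotient, etaQuotient, etaPow, etaPow, etaPow, etaPow, h, h2, logEta_add_int τ.im_pos,
    logEta_add_int him, ← Complex.exp_add, ← Complex.exp_add, ← Complex.exp_add]
  congr 1
  push_cast
  ring

lemma map_apply (γ : SL(2, ℤ)) (i j : Fin 2) :
    Matrix.SpecialLinearGroup.map (Int.castRingHom ℝ) γ i j = (γ i j : ℝ) := rfl

lemma slash_lift_apply {N : ℕ} (k : ℚ) (f : ℍ → ℂ) (γ : SL(2, ℤ)) (τ : ℍ) :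
    slash k f (Cover.lift N γ) τ = ((γ 1 0 : ℂ) * τ + γ 1 1) ^ (-(k : ℂ)) * f (γ • τ) := by
  have h1 : (Cover.lift N γ).eps = 1 := rfl
  have h2 : (Cover.lift N γ).mat = Matrix.SpecialLinearGroup.map (Int.castRingHom ℝ) γ := rfl
  rw [slash, h1, h2, autFactor_map, map_smul, Complex.one_cpow, one_mul]

lemma slashFactor_lift {N : ℕ} (k : ℚ) (γ : SL(2, ℤ)) (τ : ℍ) :
    slashFactor k (Cover.lift N γ) τ = ((γ 1 0 : ℂ) * τ + γ 1 1) ^ (-(k : ℂ)) := by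
  have h1 : (Cover.lift N γ).eps = 1 := rfl
  have h2 : (Cover.lift N γ).mat = Matrix.SpecialLinearGroup.map (Int.castRingHom ℝ) γ := rfl
  rw [slashFactor, h1, h2, autFactor_map, Complex.one_cpow, one_mul]

lemma gammaOne_apply : gammaOne 0 0 = 1 ∧ gammaOne 0 1 = 0 ∧ gammaOne 1 0 = 1 ∧
    gammaOne 1 1 = 1 := ⟨rfl, rfl, rfl, rfl⟩

/-- The expansion of the eta-quotient at the cusp `1`. -/
lemma exists_slash_gammaOne_eq {p : ℕ} (hp : 0 < p) (N : ℕ) (r₁ rp : ℚ) :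
    ∃ K : ℂ, ∀ τ : ℍ, slash ((r₁ + rp) / 2) (etaQuotient p r₁ rp) (Cover.lift N gammaOne) τ =
      K * Complex.exp (r₁ * logEta τ + rp * logEta ((τ + 1) / p)) := by
  -- Chosen because `p · γ₁τ = pτ/(τ + 1) = p - 1/w = δw` with `w = (τ + 1)/p`.
  set δ : SL(2, ℤ) := ModularGroup.T ^ (p : ℤ) * ModularGroup.S with hδ
  have hδm : (δ : Matrix (Fin 2) (Fin 2) ℤ) = !![(p : ℤ), -1; 1, 0] := by
    rw [hδ, Matrix.SpecialLinearGroup.coe_mul, ModularGroup.coe_T_zpow, ModularGroup.coe_S]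
    simp
  refine ⟨Complex.exp (r₁ * etaConst gammaOne +
    rp * (etaConst δ + 1 / 2 * (Real.log (p : ℝ)⁻¹ : ℝ))), fun τ => ?_⟩
  have hpc : (p : ℂ) ≠ 0 := by exact_mod_cast hp.ne'
  obtain ⟨g00, g01, g10, g11⟩ := gammaOne_apply
  have h0 := denom_int_ne_zero gammaOne τ
  rw [g10, g11] at h0
  push_cast at h0
  rw [one_mul] at h0
  have him : 0 < (((τ : ℂ) + 1) / p).im := by
    have : (((τ : ℂ) + 1) / p).im = τ.im / p := by simp
    rw [this]
    exact div_pos τ.im_pos (by exact_mod_cast hp)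
  have h1 := logEta_smul gammaOne τ
  have h2 := logEta_smul δ ⟨((τ : ℂ) + 1) / p, him⟩
  rw [coe_smul_int, hδm] at h2
  have h3 : (p : ℂ) * ((gammaOne • τ : ℍ) : ℂ) = (p * (((τ : ℂ) + 1) / p) + -1) /
      (1 * (((τ : ℂ) + 1) / p) + 0) := by
    rw [coe_smul_int, g00, g01, g10, g11]
    push_cast
    rw [one_mul, one_mul, add_zero, add_zero]
    field_simp
    ring
  -- Dividing by the positive real `p` only adds a real constant, absorbed in `K`; the remaining
  -- `log(τ + 1)` cancels against the weight factor.
  have h4 : Complex.log (((τ : ℂ) + 1) / p) = (Real.log (p : ℝ)⁻¹ : ℝ) + Complex.log (τ + 1) := by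
    rw [← Complex.log_ofReal_mul (inv_pos.mpr (by exact_mod_cast hp)) h0]
    congr 1
    push_cast
    ring
  simp only [Matrix.of_apply, Matrix.cons_val_zero, Matrix.cons_val_one, Matrix.cons_val',
    Matrix.cons_val_fin_one] at h2
  push_cast at h2
  rw [← h3, one_mul, add_zero, h4] at h2
  rw [g10, g11] at h1
  push_cast at h1
  rw [one_mul] at h1
  rw [slash_lift_apply, g10, g11, etaQuotient, etaPow, etaPow, h1, h2, Int.cast_one, one_mul,
    Complex.cpow_def_of_ne_zero h0, ← Complex.exp_add, ← Complex.exp_add,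
    ← Complex.exp_add]
  congr 1
  push_cast
  ring

/-- The shift `τ ↦ τ + p m` moves `(τ + 1)/p` by `m`, so the exponent gains `(p m r₁ + m r_p)
πi/12`. -/
lemma slash_gammaOne_translate {p : ℕ} (hp : 0 < p) (N : ℕ) (r₁ rp : ℚ) {τ τ' : ℍ} {m : ℤ}
    (h : (τ' : ℂ) = τ + ((p * m : ℤ) : ℂ)) :
    slash ((r₁ + rp) / 2) (etaQuotient p r₁ rp) (Cover.lift N gammaOne) τ' =
      Complex.exp (2 * Real.pi * Complex.I * (m * ((p * r₁ + rp) / 24 : ℚ))) *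
        slash ((r₁ + rp) / 2) (etaQuotient p r₁ rp) (Cover.lift N gammaOne) τ := by
  obtain ⟨K, hK⟩ := exists_slash_gammaOne_eq hp N r₁ rp
  have hpc : (p : ℂ) ≠ 0 := by exact_mod_cast hp.ne'
  have him : 0 < (((τ : ℂ) + 1) / p).im := by
    have : (((τ : ℂ) + 1) / p).im = τ.im / p := by simp
    rw [this]
    exact div_pos τ.im_pos (by exact_mod_cast hp)
  have h2 : ((τ : ℂ) + ((p * m : ℤ) : ℂ) + 1) / p = (τ + 1) / p + m := by
    push_cast
    field_simp
    ring
  rw [hK, hK, h, h2, logEta_add_int τ.im_pos, logEta_add_int him, mul_left_comm, ← Complex.exp_add]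
  congr 2
  push_cast
  ring

lemma exp_two_pi_mul_int_eq_one {q : ℚ} (hq : ∃ n : ℤ, q = n) (m : ℤ) :
    Complex.exp (2 * Real.pi * Complex.I * (m * (q : ℂ))) = 1 := by
  obtain ⟨n, rfl⟩ := hq
  exact Complex.exp_eq_one_iff.mpr ⟨m * n, by push_cast; ring⟩

lemma exp_two_pi_eq_one_iff (q : ℚ) :
    Complex.exp (2 * Real.pi * Complex.I * (((1 : ℤ) : ℂ) * (q : ℂ))) = 1 ↔ ∃ n : ℤ, q = n := by
  refine ⟨fun h => ?_, fun h => exp_two_pi_mul_int_eq_one h 1⟩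
  obtain ⟨n, hn⟩ := Complex.exp_eq_one_iff.mp h
  refine ⟨n, ?_⟩
  have h2 : (2 * Real.pi * Complex.I : ℂ) * q = (2 * Real.pi * Complex.I) * n := by
    rw [Int.cast_one, one_mul] at hn
    rw [hn]
    ring
  have := mul_left_cancel₀ Complex.two_pi_I_ne_zero h2
  exact_mod_cast this

/-! ### The stabilizers of the cusps -/

lemma slash_ne_zero {N : ℕ} [NeZero N] {k : ℚ} {f : ℍ → ℂ} (hf : ∀ τ, f τ ≠ 0) (g : Cover N)
    (τ : ℍ) : slash k f g τ ≠ 0 := by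
  rw [slash_apply]
  exact mul_ne_zero (slashFactor_ne_zero k g τ) (hf _)

/-- Computes `f|(s n)` in two ways, through `(s n s⁻¹) s` and through `s n`; the character on the
stabilizer is thus visible in the behaviour of `f|s`. -/
lemma HasMultiplier.conj_apply {N : ℕ} [NeZero N] {G : Subgroup SL(2, ℤ)} {k : ℚ}
    (hk : ∃ m : ℤ, (N : ℚ) * k = m) {f : ℍ → ℂ} {χ : Cover.preimage N G →* ℂˣ}
    (hχ : HasMultiplier k f χ) (s n : Cover N) (h : s * n * s⁻¹ ∈ Cover.preimage N G) (τ : ℍ) :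
    (χ ⟨s * n * s⁻¹, h⟩ : ℂ) * slash k f s τ =
      slashFactor k n τ * slash k f s (n.mat • τ) := by
  have h1 : slash k f (s * n * s⁻¹) = _ := hχ ⟨s * n * s⁻¹, h⟩
  have h2 : slash k (slash k f (s * n * s⁻¹)) s = slash k (slash k f s) n := by
    rw [← slash_mul hk, ← slash_mul hk, inv_mul_cancel_right]
  rw [h1, slash_smul] at h2
  have h3 := congrFun h2 τ
  rwa [Pi.smul_apply, smul_eq_mul, slash_apply k (slash k f s)] at h3

/-- An integral matrix with `c = 0` acts as a translation. -/
lemma coe_smul_of_apply_eq_zero {ε : SL(2, ℤ)} (h : ε 1 0 = 0) (τ : ℍ) :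
    ((ε • τ : ℍ) : ℂ) = τ + ((ε 0 0 * ε 0 1 : ℤ) : ℂ) ∧ ε 1 1 = ε 0 0 ∧ ε 0 0 ^ 2 = 1 := by
  have hdet : ε 0 0 * ε 1 1 = 1 := by
    have := ε.det_coe
    rw [Matrix.det_fin_two, h, mul_zero, sub_zero] at this
    exact this
  have h1 : ε 1 1 = ε 0 0 := by
    rcases Int.eq_one_or_neg_one_of_mul_eq_one' hdet with ⟨a, b⟩ | ⟨a, b⟩ <;> rw [a, b]
  have h2 : ε 0 0 ^ 2 = 1 := by
    rw [sq]
    nth_rewrite 2 [← h1]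
    exact hdet
  refine ⟨?_, h1, h2⟩
  rw [coe_smul_int, h, h1]
  have h3 : (ε 0 0 : ℂ) ^ 2 = 1 := by exact_mod_cast h2
  have h4 : (ε 0 0 : ℂ) ≠ 0 := by
    intro h0
    rw [h0] at h3
    norm_num at h3
  push_cast
  rw [zero_mul, zero_add, div_eq_iff h4]
  linear_combination (-(ε 0 1 : ℂ)) * h3

/-- If the eta-quotient is invariant at the cusp `σ ∞` under the translations in the stabilizer,
then its character agrees there with the automorphy factor of weight `k`. -/
lemma cuspCharacter_of_translate {p : ℕ} [Fact p.Prime] {r₁ rp : ℚ} {D : ℕ} [NeZero D]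
    (hr₁ : ∃ m : ℤ, (D : ℚ) * r₁ = m) (hrp : ∃ m : ℤ, (D : ℚ) * rp = m)
    {k : ℚ} (hk : 2 < k) (hkk : ∃ m : ℤ, k = (r₁ + rp) / 2 + 2 * m)
    {χ : Cover.preimage (2 * D) (CongruenceSubgroup.Gamma0 p) →* ℂˣ}
    (hχ : HasMultiplier ((r₁ + rp) / 2) (etaQuotient p r₁ rp) χ) (σ : SL(2, ℤ))
    (hσ : ∀ ε : SL(2, ℤ), ε 1 0 = 0 → σ * ε * σ⁻¹ ∈ CongruenceSubgroup.Gamma0 p →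
      ∀ τ, slash ((r₁ + rp) / 2) (etaQuotient p r₁ rp) (Cover.lift (2 * D) σ) (ε • τ) =
        slash ((r₁ + rp) / 2) (etaQuotient p r₁ rp) (Cover.lift (2 * D) σ) τ) :
    CuspCharacter k χ (Cover.lift (2 * D) σ) := by
  have hw := two_mul_weight hr₁ hrp
  obtain ⟨m, rfl⟩ := hkk
  refine ⟨?_, hk, hχ.eta_norm hr₁ hrp, fun n hn hn0 τ => ?_⟩
  · obtain ⟨l, hl⟩ := hw
    refine ⟨l + 2 * D * (2 * m), ?_⟩
    rw [mul_add, hl]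
    push_cast
    ring
  obtain ⟨γ, hγ, hγn⟩ := hn
  have hmat : n.mat = Matrix.SpecialLinearGroup.map (Int.castRingHom ℝ) (σ⁻¹ * γ * σ) := by
    have e : Matrix.SpecialLinearGroup.map (Int.castRingHom ℝ) γ =
        Matrix.SpecialLinearGroup.map (Int.castRingHom ℝ) σ * n.mat *
          (Matrix.SpecialLinearGroup.map (Int.castRingHom ℝ) σ)⁻¹ := hγn
    rw [map_mul, map_mul, map_inv, e]
    group
  have hε0 : (σ⁻¹ * γ * σ) 1 0 = 0 := by
    rw [hmat, map_apply] at hn0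
    exact_mod_cast hn0
  have hεmem : σ * (σ⁻¹ * γ * σ) * σ⁻¹ ∈ CongruenceSubgroup.Gamma0 p := by
    rw [show σ * (σ⁻¹ * γ * σ) * σ⁻¹ = γ by group]
    exact hγ
  have h1 := hχ.conj_apply hw (Cover.lift (2 * D) σ) n ⟨γ, hγ, hγn⟩ τ
  rw [hmat, map_smul, hσ _ hε0 hεmem] at h1
  rw [mul_right_cancel₀ (slash_ne_zero (etaQuotient_ne_zero p r₁ rp) _ _) h1]
  -- The eta-quotient controls weight `k'`; the passage to `k` uses that `n` lies over `±T^j`, so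
  -- `cτ + d = ±1`.
  refine (slashFactor_add_two_mul hw m n τ ?_).symm
  obtain ⟨-, h11, hsq⟩ := coe_smul_of_apply_eq_zero hε0 τ
  rw [hmat, autFactor_map, hε0, h11]
  push_cast
  rw [zero_mul, zero_add]
  exact_mod_cast hsq

lemma lift_one (N : ℕ) : Cover.lift N 1 = 1 := by
  refine Cover.ext ?_ rfl
  change Matrix.SpecialLinearGroup.map (Int.castRingHom ℝ) 1 = 1
  exact map_one _

/-- All three denominators lie in the upper half-plane, so the principal roots multiply. This is the
role of the condition `a + c > 0` in the series at the cusp 1. -/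
lemma lift_mul_lift_of_pos {N : ℕ} [NeZero N] (γ δ : SL(2, ℤ)) (hγ : 0 < γ 1 0) (hδ : 0 < δ 1 0)
    (hγδ : 0 < (γ * δ) 1 0) :
    Cover.lift N γ * Cover.lift N δ = Cover.lift N (γ * δ) := by
  have him : ∀ (γ : SL(2, ℤ)) (τ : ℍ), 0 < γ 1 0 → 0 < ((γ 1 0 : ℂ) * τ + γ 1 1).im := by
    intro γ τ h
    have : ((γ 1 0 : ℂ) * τ + γ 1 1).im = γ 1 0 * τ.im := by simp
    rw [this]
    exact mul_pos (by exact_mod_cast h) τ.im_pos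
  refine Cover.ext (map_mul _ _ _).symm ?_
  change 1 * 1 * cocycleAt N (Matrix.SpecialLinearGroup.map (Int.castRingHom ℝ) γ)
    (Matrix.SpecialLinearGroup.map (Int.castRingHom ℝ) δ) UpperHalfPlane.I = 1
  rw [one_mul, one_mul, cocycleAt, ← map_mul, rootFactor, rootFactor, rootFactor, autFactor_map,
    autFactor_map, autFactor_map, map_smul, denom_int_mul]
  have h1 := denom_int_ne_zero γ (δ • UpperHalfPlane.I)
  have h2 := denom_int_ne_zero δ UpperHalfPlane.I
  rw [Complex.cpow_def_of_ne_zero h1, Complex.cpow_def_of_ne_zero h2,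
    Complex.cpow_def_of_ne_zero (mul_ne_zero h1 h2), log_mul_of_im_pos (him _ _ hγ) (him _ _ hδ)
    (by rw [← denom_int_mul]; exact him _ _ hγδ), ← Complex.exp_add, ← add_mul]
  exact div_self (Complex.exp_ne_zero _)

lemma slashFactor_lift_T_pow {N : ℕ} [NeZero N] {k : ℚ} (hk : ∃ m : ℤ, (N : ℚ) * k = m) (j : ℕ)
    (τ : ℍ) : slashFactor k (Cover.lift N ModularGroup.T ^ j) τ = 1 := by
  induction j generalizing τ with
  | zero => rw [pow_zero, slashFactor_one]
  | succ n ih =>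
    rw [pow_succ, slashFactor_mul hk, ih, slashFactor_lift]
    simp [ModularGroup.T]

/-! ### Summation over rows up to sign -/

/-- The rows with `c < 0` are paired with those with `c > 0` by negation, and among the latter only
those in `S` contribute. -/
lemma tsum_rows_eq {t : (Fin 2 → ℤ) → ℂ} (ht : Summable t) (heven : ∀ v, t (-v) = t v)
    {S : ℤ × ℤ → Prop} (hS : ∀ x, S x → 0 < x.1)
    (h0 : ∀ x : ℤ × ℤ, 0 < x.1 → ¬ S x → t ![x.1, x.2] = 0) :
    ∑' v, t v = (∑' v : Fin 2 → ℤ, if v 0 = 0 then t v else 0) +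
      2 * ∑' x : {x // S x}, t ![x.1.1, x.1.2] := by
  have hind : ∀ P : (Fin 2 → ℤ) → Prop, ∀ _ : DecidablePred P,
      Summable fun v => if P v then t v else 0 := by
    intro P _
    refine Summable.of_norm_bounded ht.norm fun v => ?_
    split_ifs
    · exact le_rfl
    · rw [norm_zero]
      exact norm_nonneg _
  have hpos := hind (fun v => 0 < v 0) inferInstance
  have hneg := hind (fun v => v 0 < 0) inferInstance
  have hzero := hind (fun v => v 0 = 0) inferInstance
  have e1 : ∑' v, t v = (∑' v : Fin 2 → ℤ, if v 0 = 0 then t v else 0) +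
      ((∑' v : Fin 2 → ℤ, if 0 < v 0 then t v else 0) +
        ∑' v : Fin 2 → ℤ, if v 0 < 0 then t v else 0) := by
    rw [← hpos.tsum_add hneg, ← hzero.tsum_add (hpos.add hneg)]
    refine tsum_congr fun v => ?_
    rcases lt_trichotomy (v 0) 0 with h | h | h
    · simp [h, h.ne, h.not_gt]
    · simp [h]
    · simp [h, h.ne', h.not_gt]
  have e2 : (∑' v : Fin 2 → ℤ, if v 0 < 0 then t v else 0) =
      ∑' v : Fin 2 → ℤ, if 0 < v 0 then t v else 0 := by
    rw [← (Equiv.neg (Fin 2 → ℤ)).tsum_eq]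
    refine tsum_congr fun v => ?_
    simp [heven]
  have e3 : (∑' v : Fin 2 → ℤ, if 0 < v 0 then t v else 0) =
      ∑' x : {x // S x}, t ![x.1.1, x.1.2] := by
    rw [← (finTwoArrowEquiv ℤ).symm.tsum_eq]
    have := tsum_subtype {x | S x} (fun x : ℤ × ℤ => t ![x.1, x.2])
    refine Eq.trans (tsum_congr fun x => ?_) this.symm
    simp only [finTwoArrowEquiv_symm_apply, Matrix.cons_val_zero, Set.indicator, Set.mem_ofPred_eq]
    by_cases hx : S x
    · simp [hx, hS x hx]
    · by_cases hx0 : 0 < x.1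
      · simp [hx, hx0, h0 x hx0 hx]
      · simp [hx, hx0]
  rw [e1, e2, e3]
  ring

section

variable {N : ℕ} [NeZero N] {G : Subgroup SL(2, ℤ)} {k : ℚ} {χ : Cover.preimage N G →* ℂˣ}
  {s : Cover N}

/-- Right multiplication by a lift of `-1` turns a representative of `v` into one of `-v`, and
`CuspCharacter.inv_mul_eq` allows this sign. -/
lemma CuspCharacter.poincareTerm_neg (H : CuspCharacter k χ s) (hG : -1 ∈ G) (v : Fin 2 → ℤ)
    (τ : ℍ) : poincareTerm k χ s (-v) τ = poincareTerm k χ s v τ := by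
  have key : ∀ (g : Cover N) (v : Fin 2 → ℤ), s * g ∈ Cover.preimage N G → HasRow g v →
      ∃ g' : Cover N, s * g' ∈ Cover.preimage N G ∧ HasRow g' (-v) := by
    intro g v hg hv
    refine ⟨g * Cover.lift N (-1), ?_, ?_⟩
    · rw [← mul_assoc]
      exact mul_mem hg ⟨-1, hG, rfl⟩
    · have := hv.mul (h := Cover.lift N (-1)) (δ := -1) rfl
      rwa [show rowEquiv (-1) v = -v by
        ext j
        rw [rowEquiv_apply]
        fin_cases j <;> simp] at this
  by_cases hex : ∃ g : Cover N, s * g ∈ Cover.preimage N G ∧ HasRow g v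
  · obtain ⟨g, hg, hv⟩ := hex
    obtain ⟨g', hg', hv'⟩ := key g v hg hv
    rw [H.poincareTerm_eq hg' hv', H.poincareTerm_eq hg hv]
    exact (H.inv_mul_eq hg hg' hv (Or.inr hv') τ).symm
  · rw [poincareTerm_eq_zero hex, poincareTerm_eq_zero]
    rintro ⟨g, hg, hv⟩
    obtain ⟨g', hg', hv'⟩ := key g _ hg hv
    rw [neg_neg] at hv'
    exact hex ⟨g', hg', hv'⟩

/-- A row that contributes to the Poincaré series at `σ ∞` is the bottom row of some
`γ ∈ σ⁻¹ G`. -/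
lemma exists_int_of_hasRow {σ : SL(2, ℤ)} {g : Cover N} {v : Fin 2 → ℤ}
    (hg : Cover.lift N σ * g ∈ Cover.preimage N G) (hv : HasRow g v) :
    ∃ γ : SL(2, ℤ), σ * γ ∈ G ∧ γ 1 0 = v 0 ∧ γ 1 1 = v 1 := by
  obtain ⟨γ, hγ, hγg⟩ := hg
  have e : Matrix.SpecialLinearGroup.map (Int.castRingHom ℝ) γ =
      Matrix.SpecialLinearGroup.map (Int.castRingHom ℝ) σ * g.mat := hγg
  have hmat : g.mat = Matrix.SpecialLinearGroup.map (Int.castRingHom ℝ) (σ⁻¹ * γ) := by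
    rw [map_mul, map_inv, e]
    group
  refine ⟨σ⁻¹ * γ, by rwa [mul_inv_cancel_left], ?_, ?_⟩
  · have := hv.1
    rw [hmat, map_apply] at this
    exact_mod_cast this
  · have := hv.2
    rw [hmat, map_apply] at this
    exact_mod_cast this

end

/-! ### The Eisenstein series as Poincaré series -/

section

variable {p : ℕ} [Fact p.Prime] {r₁ rp : ℚ} {D : ℕ} [NeZero D] {k : ℚ}
  {χ : Cover.preimage (2 * D) (CongruenceSubgroup.Gamma0 p) →* ℂˣ}

lemma neg_one_mem_Gamma0 (p : ℕ) : -1 ∈ CongruenceSubgroup.Gamma0 p :=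
  mem_Gamma0_of_dvd (by simp)

lemma isCoprime_bottom_row (γ : SL(2, ℤ)) : IsCoprime (γ 1 0) (γ 1 1) := by
  have hdet := γ.det_coe
  rw [Matrix.det_fin_two] at hdet
  exact ⟨-γ 0 1, γ 0 0, by linarith⟩

lemma gammaOne_mul_apply (γ : SL(2, ℤ)) : (gammaOne * γ) 0 0 = γ 0 0 ∧
    (gammaOne * γ) 1 0 = γ 0 0 + γ 1 0 ∧ (gammaOne * γ) 1 1 = γ 0 1 + γ 1 1 := by
  obtain ⟨g00, g01, g10, g11⟩ := gammaOne_apply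
  simp only [Matrix.SpecialLinearGroup.coe_mul, Matrix.mul_apply, Fin.sum_univ_two, g00, g01, g10,
    g11]
  refine ⟨by ring, by ring, by ring⟩

lemma poincareTerm_eq_eisCoeff (hχ : HasMultiplier ((r₁ + rp) / 2) (etaQuotient p r₁ rp) χ)
    {σ : SL(2, ℤ)} (H : CuspCharacter k χ (Cover.lift (2 * D) σ)) {γ : SL(2, ℤ)}
    (hmul : Cover.lift (2 * D) σ * Cover.lift (2 * D) γ = Cover.lift (2 * D) (σ * γ))
    (hdvd : (p : ℤ) ∣ (σ * γ) 1 0) (hpos : 0 < (σ * γ) 1 0) (τ : ℍ) :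
    poincareTerm k χ (Cover.lift (2 * D) σ) ![γ 1 0, γ 1 1] τ =
      ((γ 1 0 : ℂ) * τ + γ 1 1) ^ (-(k : ℂ)) *
        eisCoeff p r₁ rp ((σ * γ) 0 0) ((σ * γ) 1 0) ((σ * γ) 1 1) := by
  have hmem : Cover.lift (2 * D) σ * Cover.lift (2 * D) γ ∈
      Cover.preimage (2 * D) (CongruenceSubgroup.Gamma0 p) := by
    rw [hmul]
    exact ⟨σ * γ, mem_Gamma0_of_dvd hdvd, rfl⟩
  have hrow : HasRow (Cover.lift (2 * D) γ) ![γ 1 0, γ 1 1] := ⟨rfl, rfl⟩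
  have heps : (Cover.lift (2 * D) σ * Cover.lift (2 * D) γ).eps = 1 := by
    rw [hmul]
    rfl
  have hmat : (Cover.lift (2 * D) σ * Cover.lift (2 * D) γ).mat =
      Matrix.SpecialLinearGroup.map (Int.castRingHom ℝ) (σ * γ) := by
    rw [hmul]
    rfl
  rw [H.poincareTerm_eq hmem hrow, slashFactor_lift, hχ.eta_apply ⟨_, hmem⟩ (σ * γ) hdvd hmat,
    eisCoeff_eq (Fact.out : p.Prime).pos r₁ rp (σ * γ) hdvd hpos]
  simp only [heps, Complex.one_cpow, one_mul]
  ring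

lemma cuspCharacter_infty (hr₁ : ∃ m : ℤ, (D : ℚ) * r₁ = m) (hrp : ∃ m : ℤ, (D : ℚ) * rp = m)
    (hk : 2 < k) (hkk : ∃ m : ℤ, k = (r₁ + rp) / 2 + 2 * m)
    (hχ : HasMultiplier ((r₁ + rp) / 2) (etaQuotient p r₁ rp) χ)
    (hn : ∃ n : ℤ, (r₁ + p * rp) / 24 = n) : CuspCharacter k χ (Cover.lift (2 * D) 1) := by
  refine cuspCharacter_of_translate hr₁ hrp hk hkk hχ 1 fun ε hε _ τ => ?_
  have h1 : ∀ τ, slash ((r₁ + rp) / 2) (etaQuotient p r₁ rp) (Cover.lift (2 * D) 1) τ =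
      etaQuotient p r₁ rp τ := by
    intro τ
    rw [slash_lift_apply]
    simp
  rw [h1, h1, etaQuotient_translate (Fact.out : p.Prime).pos r₁ rp
    (coe_smul_of_apply_eq_zero hε τ).1, exp_two_pi_mul_int_eq_one hn, one_mul]

lemma cuspCharacter_one (hr₁ : ∃ m : ℤ, (D : ℚ) * r₁ = m) (hrp : ∃ m : ℤ, (D : ℚ) * rp = m)
    (hk : 2 < k) (hkk : ∃ m : ℤ, k = (r₁ + rp) / 2 + 2 * m)
    (hχ : HasMultiplier ((r₁ + rp) / 2) (etaQuotient p r₁ rp) χ)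
    (hn : ∃ n : ℤ, (p * r₁ + rp) / 24 = n) :
    CuspCharacter k χ (Cover.lift (2 * D) gammaOne) := by
  refine cuspCharacter_of_translate hr₁ hrp hk hkk hχ gammaOne fun ε hε hmem τ => ?_
  obtain ⟨hsmul, h11, -⟩ := coe_smul_of_apply_eq_zero hε τ
  -- The cusp 1 has width `p`: the conjugate by `γ₁` has lower left entry `-ε 0 1`, so only
  -- translations by multiples of `p` occur.
  have hdvd : (p : ℤ) ∣ ε 0 1 := by
    have h := dvd_of_mem_Gamma0 hmem
    have hG : (gammaOne : Matrix (Fin 2) (Fin 2) ℤ) = !![1, 0; 1, 1] := rfl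
    have e : (gammaOne * ε * gammaOne⁻¹) 1 0 = -ε 0 1 := by
      obtain ⟨-, e10, e11⟩ := gammaOne_mul_apply ε
      rw [Matrix.SpecialLinearGroup.coe_mul, Matrix.mul_apply, Fin.sum_univ_two, e10, e11,
        Matrix.SpecialLinearGroup.coe_inv, hG, Matrix.adjugate_fin_two]
      simp [hε, h11]
    rw [e] at h
    exact (dvd_neg).mp h
  obtain ⟨b, hb⟩ := hdvd
  rw [hb, mul_left_comm] at hsmul
  rw [slash_gammaOne_translate (Fact.out : p.Prime).pos (2 * D) r₁ rp hsmul,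
    exp_two_pi_mul_int_eq_one hn, one_mul]

/-- Any admissible `a` completes `(c, d)` to a matrix in Γ₀(p). The right side does not involve `a`,
hence the independence of the choice. -/
lemma termInfty_eq_poincareTerm (hχ : HasMultiplier ((r₁ + rp) / 2) (etaQuotient p r₁ rp) χ)
    (H : CuspCharacter k χ (Cover.lift (2 * D) 1)) (x : IndexInfty p) {a : ℤ}
    (ha : AdmissibleInfty x.1.1 x.1.2 a) (τ : ℍ) :
    termInfty p k r₁ rp x.1.1 x.1.2 a τ =
      poincareTerm k χ (Cover.lift (2 * D) 1) ![x.1.1, x.1.2] τ := by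
  obtain ⟨⟨c, d⟩, hc, hpc, hcd⟩ := x
  obtain ⟨b, hb⟩ := Int.modEq_iff_dvd.mp ha
  simp only at hc hpc hb ⊢
  set γ : SL(2, ℤ) := ⟨!![a, -b; c, d], by
    rw [Matrix.det_fin_two_of]
    linear_combination -hb⟩ with hγ
  have e := poincareTerm_eq_eisCoeff hχ H (γ := γ) (by rw [lift_one, one_mul, one_mul])
    (by rw [one_mul]; exact hpc) (by rw [one_mul]; exact hc) τ
  rw [one_mul] at e
  rw [show (![c, d] : Fin 2 → ℤ) = ![γ 1 0, γ 1 1] from rfl, e]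
  rfl

lemma termOne_eq_poincareTerm (hχ : HasMultiplier ((r₁ + rp) / 2) (etaQuotient p r₁ rp) χ)
    (H : CuspCharacter k χ (Cover.lift (2 * D) gammaOne)) (x : IndexOne p) {ab : ℤ × ℤ}
    (hab : AdmissibleOne p x.1.1 x.1.2 ab) (τ : ℍ) :
    termOne p k r₁ rp x.1.1 x.1.2 ab τ =
      poincareTerm k χ (Cover.lift (2 * D) gammaOne) ![x.1.1, x.1.2] τ := by
  obtain ⟨⟨c, d⟩, hc, hpc, hcd⟩ := x
  obtain ⟨a, b⟩ := ab
  obtain ⟨hdet, hdvd, hpos⟩ := hab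
  simp only at hc hpc hdet hdvd hpos ⊢
  set γ : SL(2, ℤ) := ⟨!![a, b; c, d], by rw [Matrix.det_fin_two_of]; exact hdet⟩ with hγ
  obtain ⟨e00, e10, e11⟩ := gammaOne_mul_apply γ
  have hpos' : 0 < (gammaOne * γ) 1 0 := by
    rw [e10]
    exact hpos
  have e := poincareTerm_eq_eisCoeff hχ H (γ := γ)
    (lift_mul_lift_of_pos gammaOne γ one_pos hc hpos') (by rw [e10]; exact hdvd) hpos' τ
  rw [e00, e10, e11] at e
  rw [show (![c, d] : Fin 2 → ℤ) = ![γ 1 0, γ 1 1] from rfl, e]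
  rfl

lemma row_injective {S : ℤ × ℤ → Prop} :
    Function.Injective fun x : {x // S x} => (![x.1.1, x.1.2] : Fin 2 → ℤ) := by
  intro x y h
  have h0 := congrFun h 0
  have h1 := congrFun h 1
  exact Subtype.ext (Prod.ext h0 h1)

lemma poincare_infty (hχ : HasMultiplier ((r₁ + rp) / 2) (etaQuotient p r₁ rp) χ)
    (H : CuspCharacter k χ (Cover.lift (2 * D) 1)) :
    eisInfty p k r₁ rp = (1 / 2 : ℂ) • poincare k χ (Cover.lift (2 * D) 1) := by
  funext τ
  set t : (Fin 2 → ℤ) → ℂ := fun v => poincareTerm k χ (Cover.lift (2 * D) 1) v τ with ht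
  have hzero : ∀ v : Fin 2 → ℤ, ¬ ((p : ℤ) ∣ v 0 ∧ IsCoprime (v 0) (v 1)) → t v = 0 := by
    intro v hv
    refine poincareTerm_eq_zero ?_ τ
    rintro ⟨g, hg, hrow⟩
    obtain ⟨γ, hγ, h0, h1⟩ := exists_int_of_hasRow hg hrow
    rw [one_mul] at hγ
    refine hv ⟨?_, ?_⟩
    · rw [← h0]
      exact dvd_of_mem_Gamma0 hγ
    · rw [← h0, ← h1]
      exact isCoprime_bottom_row γ
  have heven : ∀ v, t (-v) = t v := fun v => H.poincareTerm_neg (neg_one_mem_Gamma0 p) v τ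
  have hone : t ![0, 1] = 1 := by
    have hmem : Cover.lift (2 * D) 1 * 1 ∈
        Cover.preimage (2 * D) (CongruenceSubgroup.Gamma0 p) := by
      rw [lift_one, one_mul]
      exact one_mem _
    have hrow : HasRow (1 : Cover (2 * D)) ![0, 1] := by
      have e : (1 : Cover (2 * D)).mat = 1 := rfl
      constructor <;> rw [e] <;> simp
    have e : (⟨Cover.lift (2 * D) 1 * 1, hmem⟩ :
        Cover.preimage (2 * D) (CongruenceSubgroup.Gamma0 p)) = 1 := by
      ext1
      simp only [lift_one, one_mul, Subgroup.coe_one]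
    rw [ht]
    simp only
    rw [H.poincareTerm_eq hmem hrow, slashFactor_one, e, map_one]
    simp
  -- Coprimality leaves only the rows `(0, 1)` and `(0, -1)`, each contributing 1; after halving
  -- they become the constant term.
  have hc0 : (∑' v : Fin 2 → ℤ, if v 0 = 0 then t v else 0) = 2 := by
    rw [tsum_eq_sum (s := {![0, 1], -![0, 1]})]
    · rw [Finset.sum_pair]
      · rw [heven, hone]
        norm_num
      · intro h
        have := congrFun h 1
        simp at this
    · intro v hv
      split_ifs with h0
      · refine hzero v fun ⟨_, hcop⟩ => hv ?_
        rw [h0, isCoprime_zero_left, Int.isUnit_iff] at hcop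
        rw [Finset.mem_insert, Finset.mem_singleton]
        rcases hcop with h | h
        · left
          ext j
          fin_cases j
          · exact h0
          · exact h
        · right
          ext j
          fin_cases j
          · exact h0
          · exact h
      · rfl
  have hsum := tsum_rows_eq (t := t) (H.summable_poincareTerm τ) heven
    (S := fun x => 0 < x.1 ∧ (p : ℤ) ∣ x.1 ∧ IsCoprime x.1 x.2) (fun x hx => hx.1)
    (fun x hx hS => hzero _ fun h => hS ⟨hx, h⟩)
  rw [hc0] at hsum
  have hterm : ∑' x : IndexInfty p,
      termInfty p k r₁ rp x.1.1 x.1.2 (exists_admissibleInfty x).choose τ =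
      ∑' x : IndexInfty p, t ![x.1.1, x.1.2] :=
    tsum_congr fun x => termInfty_eq_poincareTerm hχ H x (exists_admissibleInfty x).choose_spec τ
  rw [eisInfty, hterm, Pi.smul_apply, smul_eq_mul, poincare]
  rw [hsum]
  ring

lemma poincare_one (hχ : HasMultiplier ((r₁ + rp) / 2) (etaQuotient p r₁ rp) χ)
    (H : CuspCharacter k χ (Cover.lift (2 * D) gammaOne)) :
    eisOne p k r₁ rp = (1 / 2 : ℂ) • poincare k χ (Cover.lift (2 * D) gammaOne) := by
  funext τ
  set t : (Fin 2 → ℤ) → ℂ := fun v => poincareTerm k χ (Cover.lift (2 * D) gammaOne) v τ with ht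
  have hzero : ∀ v : Fin 2 → ℤ, ¬ (IsCoprime (p : ℤ) (v 0) ∧ IsCoprime (v 0) (v 1)) →
      t v = 0 := by
    intro v hv
    refine poincareTerm_eq_zero ?_ τ
    rintro ⟨g, hg, hrow⟩
    obtain ⟨γ, hγ, h0, h1⟩ := exists_int_of_hasRow hg hrow
    refine hv ⟨?_, ?_⟩
    · rw [← h0]
      obtain ⟨m, hm⟩ := dvd_of_mem_Gamma0 hγ
      rw [(gammaOne_mul_apply γ).2.1] at hm
      have hdet := γ.det_coe
      rw [Matrix.det_fin_two] at hdet
      -- With `a + c = p m`, one has `p m d - c (d + b) = a d - b c = 1`.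
      exact ⟨m * γ 1 1, -γ 1 1 - γ 0 1, by linear_combination hdet - γ 1 1 * hm⟩
    · rw [← h0, ← h1]
      exact isCoprime_bottom_row γ
  have heven : ∀ v, t (-v) = t v := fun v => H.poincareTerm_neg (neg_one_mem_Gamma0 p) v τ
  -- The prime `p` is not coprime to 0, so no row with `c = 0` contributes and the series has no
  -- separate constant term.
  have hc0 : (∑' v : Fin 2 → ℤ, if v 0 = 0 then t v else 0) = 0 := by
    refine (tsum_congr fun v => ?_).trans tsum_zero
    split_ifs with h0
    · refine hzero v fun ⟨hcop, _⟩ => ?_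
      rw [h0, isCoprime_zero_right] at hcop
      exact (Nat.prime_iff_prime_int.mp (Fact.out : p.Prime)).not_isUnit hcop
    · rfl
  have hsum := tsum_rows_eq (t := t) (H.summable_poincareTerm τ) heven
    (S := fun x => 0 < x.1 ∧ IsCoprime (p : ℤ) x.1 ∧ IsCoprime x.1 x.2) (fun x hx => hx.1)
    (fun x hx hS => hzero _ fun h => hS ⟨hx, h⟩)
  rw [hc0] at hsum
  have hterm : ∑' x : IndexOne p,
      termOne p k r₁ rp x.1.1 x.1.2 (exists_admissibleOne x).choose τ =
      ∑' x : IndexOne p, t ![x.1.1, x.1.2] :=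
    tsum_congr fun x => termOne_eq_poincareTerm hχ H x (exists_admissibleOne x).choose_spec τ
  rw [eisOne, hterm, Pi.smul_apply, smul_eq_mul, poincare]
  rw [hsum]
  ring

/-! ### The values of the character on the stabilizers -/

lemma HasMultiplier.tildeT_eq_one_iff
    (hχ : HasMultiplier ((r₁ + rp) / 2) (etaQuotient p r₁ rp) χ) :
    χ (tildeT (2 * D) p) = 1 ↔ ∃ n : ℤ, (r₁ + p * rp) / 24 = n := by
  rw [← exp_two_pi_eq_one_iff, ← Units.val_eq_one]
  have h1 := congrFun (hχ (tildeT (2 * D) p)) UpperHalfPlane.I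
  have h2 : ((tildeT (2 * D) p : Cover.preimage (2 * D) (CongruenceSubgroup.Gamma0 p)) :
      Cover (2 * D)) = Cover.lift (2 * D) ModularGroup.T := rfl
  have hT : ((ModularGroup.T • UpperHalfPlane.I : ℍ) : ℂ) =
      UpperHalfPlane.I + ((1 : ℤ) : ℂ) := by
    rw [coe_smul_int]
    simp [ModularGroup.T]
  rw [h2, slash_lift_apply, etaQuotient_translate (Fact.out : p.Prime).pos r₁ rp hT,
    Pi.smul_apply, smul_eq_mul] at h1
  have h3 : ((ModularGroup.T 1 0 : ℤ) : ℂ) * (UpperHalfPlane.I : ℂ) +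
      ((ModularGroup.T 1 1 : ℤ) : ℂ) = 1 := by
    simp [ModularGroup.T]
  rw [h3, Complex.one_cpow, one_mul] at h1
  rw [mul_right_cancel₀ (etaQuotient_ne_zero p r₁ rp _) h1]

/-- The lift of `T^p` has trivial automorphy factor, so the value of `χ` is exactly the factor
`e(n_1)` by which `f|γ₁` changes under `τ ↦ τ + p`. -/
lemma HasMultiplier.tildeConj_eq_one_iff (hr₁ : ∃ m : ℤ, (D : ℚ) * r₁ = m)
    (hrp : ∃ m : ℤ, (D : ℚ) * rp = m)
    (hχ : HasMultiplier ((r₁ + rp) / 2) (etaQuotient p r₁ rp) χ) :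
    χ (tildeConj (2 * D) p) = 1 ↔ ∃ n : ℤ, (p * r₁ + rp) / 24 = n := by
  rw [← exp_two_pi_eq_one_iff, ← Units.val_eq_one]
  have hw := two_mul_weight hr₁ hrp
  have h1 := hχ.conj_apply hw (Cover.lift (2 * D) gammaOne) (Cover.lift (2 * D) ModularGroup.T ^ p)
    (tildeConj (2 * D) p).2 UpperHalfPlane.I
  have hmat : (Cover.lift (2 * D) ModularGroup.T ^ p).mat =
      Matrix.SpecialLinearGroup.map (Int.castRingHom ℝ) (ModularGroup.T ^ (p : ℤ)) := by
    have e := map_pow (Cover.proj (2 * D)) (Cover.lift (2 * D) ModularGroup.T) p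
    rw [zpow_natCast, map_pow]
    exact e
  have hT : ((ModularGroup.T ^ (p : ℤ) • UpperHalfPlane.I : ℍ) : ℂ) =
      UpperHalfPlane.I + ((p * 1 : ℤ) : ℂ) := by
    rw [coe_smul_int, ModularGroup.coe_T_zpow]
    simp
  rw [slashFactor_lift_T_pow hw, one_mul, hmat, map_smul,
    slash_gammaOne_translate (Fact.out : p.Prime).pos (2 * D) r₁ rp hT] at h1
  have h2 := mul_right_cancel₀ (slash_ne_zero (etaQuotient_ne_zero p r₁ rp) _ _) h1
  rw [← h2]
  rfl

end

end RationalWeight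

end

theorem theorem6p1 (p : ℕ) [Fact p.Prime] (r₁ rp : ℚ) (D : ℕ) [NeZero D]
    (hr₁ : ∃ m : ℤ, (D : ℚ) * r₁ = m) (hrp : ∃ m : ℤ, (D : ℚ) * rp = m)
    (k : ℚ) (hk : 2 < k) (hkk : ∃ m : ℤ, k = (r₁ + rp) / 2 + 2 * m) :
    -- the multiplier system of the eta-quotient is a well-defined character
    (∃! χ : RationalWeight.Cover.preimage (2 * D) (CongruenceSubgroup.Gamma0 p) →* ℂˣ,
      RationalWeight.HasMultiplier ((r₁ + rp) / 2) (RationalWeight.etaQuotient p r₁ rp) χ) ∧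
    ∀ χ : RationalWeight.Cover.preimage (2 * D) (CongruenceSubgroup.Gamma0 p) →* ℂˣ,
      RationalWeight.HasMultiplier ((r₁ + rp) / 2) (RationalWeight.etaQuotient p r₁ rp) χ →
      χ.ker.FiniteIndex ∧
      -- the cusp `i∞`
      (χ (RationalWeight.tildeT (2 * D) p) = 1 ↔ ∃ n : ℤ, (r₁ + p * rp) / 24 = n) ∧
      ((∃ n : ℤ, (r₁ + p * rp) / 24 = n) →
        (∀ (x : RationalWeight.IndexInfty p) (a a' : ℤ),
          RationalWeight.AdmissibleInfty x.1.1 x.1.2 a →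
          RationalWeight.AdmissibleInfty x.1.1 x.1.2 a' →
          RationalWeight.termInfty p k r₁ rp x.1.1 x.1.2 a =
            RationalWeight.termInfty p k r₁ rp x.1.1 x.1.2 a') ∧
        (∀ τ : UpperHalfPlane, Summable fun x : RationalWeight.IndexInfty p =>
          RationalWeight.termInfty p k r₁ rp x.1.1 x.1.2
            (RationalWeight.exists_admissibleInfty x).choose τ) ∧
        RationalWeight.eisInfty p k r₁ rp ∈ RationalWeight.modularForms k χ) ∧
      -- the cusp `1`
      (χ (RationalWeight.tildeConj (2 * D) p) = 1 ↔ ∃ n : ℤ, (p * r₁ + rp) / 24 = n) ∧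
      ((∃ n : ℤ, (p * r₁ + rp) / 24 = n) →
        (∀ (x : RationalWeight.IndexOne p) (ab ab' : ℤ × ℤ),
          RationalWeight.AdmissibleOne p x.1.1 x.1.2 ab →
          RationalWeight.AdmissibleOne p x.1.1 x.1.2 ab' →
          RationalWeight.termOne p k r₁ rp x.1.1 x.1.2 ab =
            RationalWeight.termOne p k r₁ rp x.1.1 x.1.2 ab') ∧
        (∀ τ : UpperHalfPlane, Summable fun x : RationalWeight.IndexOne p =>
          RationalWeight.termOne p k r₁ rp x.1.1 x.1.2
            (RationalWeight.exists_admissibleOne x).choose τ) ∧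
        RationalWeight.eisOne p k r₁ rp ∈ RationalWeight.modularForms k χ) := by
  refine ⟨RationalWeight.existsUnique_etaCharacter hr₁ hrp, fun χ hχ => ?_⟩
  refine ⟨hχ.eta_finiteIndex_ker hr₁ hrp, hχ.tildeT_eq_one_iff, fun hn => ?_,
    hχ.tildeConj_eq_one_iff hr₁ hrp, fun hn => ?_⟩
  · have H := RationalWeight.cuspCharacter_infty hr₁ hrp hk hkk hχ hn
    refine ⟨fun x a a' ha ha' => ?_, fun τ => ?_, ?_⟩
    · funext τ
      rw [RationalWeight.termInfty_eq_poincareTerm hχ H x ha,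
        RationalWeight.termInfty_eq_poincareTerm hχ H x ha']
    · refine ((H.summable_poincareTerm τ).comp_injective
        RationalWeight.row_injective).congr fun x => ?_
      exact (RationalWeight.termInfty_eq_poincareTerm hχ H x
        (RationalWeight.exists_admissibleInfty x).choose_spec τ).symm
    · rw [RationalWeight.poincare_infty hχ H]
      exact Submodule.smul_mem _ _ H.poincare_mem
  · have H := RationalWeight.cuspCharacter_one hr₁ hrp hk hkk hχ hn
    refine ⟨fun x ab ab' hab hab' => ?_, fun τ => ?_, ?_⟩
    · funext τ
      rw [RationalWeight.termOne_eq_poincareTerm hχ H x hab,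
        RationalWeight.termOne_eq_poincareTerm hχ H x hab']
    · refine ((H.summable_poincareTerm τ).comp_injective
        RationalWeight.row_injective).congr fun x => ?_
      exact (RationalWeight.termOne_eq_poincareTerm hχ H x
        (RationalWeight.exists_admissibleOne x).choose_spec τ).symm
    · rw [RationalWeight.poincare_one hχ H]
      exact Submodule.smul_mem _ _ H.poincare_mem
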